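/- Let $\mathbb{M}=\mathbb{R}\times\mathbb{R}^3$ be Minkowski spacetime with metric $-dt^2+d\mathbf{x}^2$, $\Box=-\partial_t^2+\sum_{i=1}^3\partial_{x_i}^2$, and $J^+(A)=\{(t,\mathbf{x}) : \exists (s,\mathbf{y})\in A,\ |\mathbf{x}-\mathbf{y}|\le t-s\}$ the causal future of $A\subset\mathbb{M}$. Let $M_1\in C^\infty(\mathbb{M},\mathbb{R})$ and $M\in C^\infty_0(\mathbb{M},\mathbb{R})$ be arbitrary, and set $P_1=-\Box+M_1$, $P_2=-\Box+M_1+M$, and $Q(\phi)=\frac12\int_{\mathbb{M}} M\phi^2\,dx$, with first functional derivative $Q^{(1)}(\phi)=M\phi$. The support of $Q$ is the set of points $x$ such that every neighbourhood $U$ of $x$ admits $\phi,\psi\in C^\infty(\mathbb{M},\mathbb{R})$ with $\mathrm{supp}\,\psi\subset U$ and $Q(\phi+\psi)\neq Q(\phi)$. Then there is a unique retarded Green's operator $\Delta^R_1$ of $P_1$, i.e. a unique linear map $\Delta^R_1:C^\infty_0(\mathbb{M},\mathbb{R})\to C^\infty(\mathbb{M},\mathbb{R})$ with $P_1\Delta^R_1f=f$,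 $\Delta^R_1P_1f=f$ and $\mathrm{supp}(\Delta^R_1f)\subset J^+(\mathrm{supp} f)$ for all $f\in C_0^\infty(\mathbb{M},\mathbb{R})$; there is a unique classical M{\o}ller map $R_{1,Q}:C^\infty(\mathbb{M},\mathbb{R})\to C^\infty(\mathbb{M},\mathbb{R})$, i.e. a unique map with $P_2\circ R_{1,Q}=P_1$ and $R_{1,Q}(\phi)=\phi$ on $\mathbb{M}\setminus J^+(\mathrm{supp}\,Q)$ for all $\phi$; and, with $r=-\Delta^R_1\circ Q^{(1)}$, for every $\phi\in C^\infty(\mathbb{M},\mathbb{R})$ the Neumann series $\sum_{n\ge0}r^n(\phi)$ converges to $R_{1,Q}(\phi)$ in the topology of $C^\infty(\mathbb{M},\mathbb{R})$, that is, the partial sums and all their derivatives converge uniformly on every compact set. -/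

import Mathlib

open Filter Topology MeasureTheory
open scoped ContDiff Manifold

noncomputable section

/-- Minkowski spacetime `ℝ⁴ = ℝ × ℝ³`: points are `(t, 𝐱)`; the metric is `-dt² + d𝐱²`. -/
abbrev Minkowski : Type := ℝ × EuclideanSpace ℝ (Fin 3)

/-- The space `C^∞(ℝ⁴, ℝ)` of off-shell field configurations. -/
abbrev Config : Type := C^∞⟮𝓘(ℝ, Minkowski), Minkowski; 𝓘(ℝ, ℝ), ℝ⟯

namespace Config

theorem contDiff (φ : Config) : ContDiff ℝ ∞ φ := φ.contMDiff.contDiff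

/-- The `k`-th total derivative of a smooth function, as a continuous map. -/
def iteratedDerivMap (k : ℕ) (φ : Config) : C(Minkowski, Minkowski [×k]→L[ℝ] ℝ) :=
  ⟨iteratedFDeriv ℝ k φ, φ.contDiff.continuous_iteratedFDeriv (mod_cast le_top)⟩

/-- The usual Fréchet topology of `C^∞`: uniform convergence on compact sets of all derivatives
(the compact-open topology on each `C(Minkowski, _)` is that of uniform convergence on compacts). -/
instance topology : TopologicalSpace Config :=
  ⨅ k : ℕ, TopologicalSpace.induced (iteratedDerivMap k) inferInstance

/-- The partial derivative `∂_v` in the constant direction `v`. -/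
def partialDeriv (v : Minkowski) : Config →ₗ[ℝ] Config where
  toFun φ := ⟨fun x => fderiv ℝ φ x v,
    ((φ.contDiff.fderiv_right (m := ∞) (mod_cast le_top)).clm_apply contDiff_const).contMDiff⟩
  map_add' φ ψ := by
    ext x
    have h := fderiv_add (φ.contDiff.differentiable (by simp) x)
      (ψ.contDiff.differentiable (by simp) x)
    exact congrArg (fun L => L v) h
  map_smul' c φ := by
    ext x
    have h := fderiv_const_smul (φ.contDiff.differentiable (by simp) x) c
    exact congrArg (fun L => L v) h

end Config

/-- The coordinate vector field `∂_t`. -/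
def timeDir : Minkowski := (1, 0)

/-- The coordinate vector fields `∂_{x_i}`, `i = 1, 2, 3`. -/
def spaceDir (i : Fin 3) : Minkowski := (0, EuclideanSpace.single i 1)

/-- The d'Alembert operator `□ = -∂_t² + ∂_{x_1}² + ∂_{x_2}² + ∂_{x_3}²`. -/
def dAlembert : Config →ₗ[ℝ] Config :=
  -(Config.partialDeriv timeDir ∘ₗ Config.partialDeriv timeDir)
    + ∑ i : Fin 3, Config.partialDeriv (spaceDir i) ∘ₗ Config.partialDeriv (spaceDir i)

/-- The Klein-Gordon operator `P = -□ + m` with smooth mass term `m`. -/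
def kleinGordon (m : Config) : Config →ₗ[ℝ] Config :=
  -dAlembert + LinearMap.mulLeft ℝ m

/-- The space of smooth functions with compact support. -/
def TestFun : Submodule ℝ Config where
  carrier := {f | HasCompactSupport f}
  add_mem' hf hg := HasCompactSupport.add hf hg
  zero_mem' := HasCompactSupport.zero
  smul_mem' c _ hf := HasCompactSupport.smul_left (f := fun _ => c) hf

theorem partialDeriv_mem_testFun (v : Minkowski) {f : Config} (hf : f ∈ TestFun) :
    Config.partialDeriv v f ∈ TestFun :=
  HasCompactSupport.fderiv_apply (𝕜 := ℝ) hf v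

theorem mul_mem_testFun {f : Config} (hf : f ∈ TestFun) (φ : Config) : f * φ ∈ TestFun :=
  HasCompactSupport.mul_right hf

theorem kleinGordon_mem_testFun (m : Config) {f : Config} (hf : f ∈ TestFun) :
    kleinGordon m f ∈ TestFun := by
  have h2 (v : Minkowski) : Config.partialDeriv v (Config.partialDeriv v f) ∈ TestFun :=
    partialDeriv_mem_testFun v (partialDeriv_mem_testFun v hf)
  have hm : m * f ∈ TestFun := mul_comm f m ▸ mul_mem_testFun hf m
  simp only [kleinGordon, dAlembert, LinearMap.add_apply, LinearMap.neg_apply,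
    LinearMap.sum_apply, LinearMap.comp_apply, LinearMap.mulLeft_apply]
  exact add_mem (neg_mem (add_mem (neg_mem (h2 _)) (sum_mem fun i _ => h2 _))) hm

/-- The causal future `J⁺(A)`: all points reached from `A` by a future-directed causal (possibly
trivial) straight line, hence by a future-directed causal curve. -/
def causalFuture (A : Set Minkowski) : Set Minkowski :=
  {x | ∃ y ∈ A, ‖x.2 - y.2‖ ≤ x.1 - y.1}

/-- `G : C^∞_0 → C^∞` is a retarded Green's operator of `P_m = -□ + m`: `P_m G f = f`,
`G P_m f = f` and `supp (G f) ⊆ J⁺(supp f)` for all test functions `f`. -/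
structure IsRetardedGreen (m : Config) (G : TestFun →ₗ[ℝ] Config) : Prop where
  right_inverse : ∀ f : TestFun, kleinGordon m (G f) = f
  left_inverse : ∀ f : TestFun, G ⟨kleinGordon m f, kleinGordon_mem_testFun m f.2⟩ = f
  supp_subset : ∀ f : TestFun, tsupport (G f) ⊆ causalFuture (tsupport (f : Config))

/-- The support of a functional on field configurations. -/
def functionalSupport (F : Config → ℝ) : Set Minkowski :=
  {x | ∀ U ∈ 𝓝 x, ∃ φ ψ : Config, tsupport ψ ⊆ U ∧ F (φ + ψ) ≠ F φ}

/-- `F1` is the first functional derivative of `F` (as an integral kernel). -/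
def HasFunctionalDeriv (F : Config → ℝ) (F1 : Config → Config) : Prop :=
  ∀ (φ : Config) (h : TestFun),
    HasDerivAt (fun s : ℝ => F (φ + s • (h : Config)))
      (∫ x, F1 φ x * (h : Config) x) 0

/-- The pure mass perturbation `Q(φ) = ½ ∫ M φ²`. -/
def massFunctional (M : TestFun) (φ : Config) : ℝ :=
  (1 / 2) * ∫ x, (M : Config) x * φ x ^ 2

/-- The linear map `Q⁽¹⁾ : φ ↦ M φ`. -/
def massDeriv (M : TestFun) : Config →ₗ[ℝ] TestFun :=
  (LinearMap.mulLeft ℝ (M : Config)).codRestrict TestFun fun φ => mul_mem_testFun M.2 φ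

/-- `massDeriv M` is the first functional derivative of `massFunctional M`. -/
theorem hasFunctionalDeriv_massFunctional (M : TestFun) :
    HasFunctionalDeriv (massFunctional M) (fun φ => massDeriv M φ) := by
  intro φ h
  have int (g : Config) : Integrable (fun x => (M : Config) x * g x) :=
    ((M : Config) * g).contDiff.continuous.integrable_of_hasCompactSupport
      (mul_mem_testFun M.2 g)
  have key (s : ℝ) : massFunctional M (φ + s • (h : Config)) =
      massFunctional M φ + s * (∫ x, (M : Config) x * (φ * (h : Config)) x)
        + s ^ 2 * massFunctional M h := by
    have e : (fun x => (M : Config) x * (φ + s • (h : Config)) x ^ 2) = fun x =>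
        (M : Config) x * (φ * φ) x + 2 * s * ((M : Config) x * (φ * (h : Config)) x)
          + s ^ 2 * ((M : Config) x * ((h : Config) * (h : Config)) x) := by
      funext x
      simp only [ContMDiffMap.coe_add, ContMDiffMap.coe_smul, ContMDiffMap.coe_mul,
        Pi.add_apply, Pi.smul_apply, Pi.mul_apply, smul_eq_mul]
      ring
    unfold massFunctional
    have i1 : Integrable (fun x => (M : Config) x * (φ * φ) x
        + 2 * s * ((M : Config) x * (φ * (h : Config)) x)) :=
      (int _).add ((int _).const_mul _)
    rw [e, integral_add i1 ((int _).const_mul _),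
      integral_add (int _) ((int _).const_mul _), integral_const_mul, integral_const_mul]
    simp only [ContMDiffMap.coe_mul, Pi.mul_apply, pow_two]
    ring
  have hI : (∫ x, ((massDeriv M φ : TestFun) : Config) x * (h : Config) x)
      = ∫ x, (M : Config) x * (φ * (h : Config)) x := by
    congr 1
    funext x
    exact mul_assoc _ _ _
  simp only [key]
  rw [hI]
  have d := (((hasDerivAt_id (0 : ℝ)).mul_const
    (∫ x, (M : Config) x * (φ * (h : Config)) x)).const_add (massFunctional M φ)).add
    (((hasDerivAt_id (0 : ℝ)).pow 2).mul_const (massFunctional M h))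
  refine d.congr_deriv ?_
  simp

/-- `R` is the retarded classical Møller map on configurations from the theory with mass term `m₁`
to the one with mass term `m₁ + M`, i.e. perturbed by `Q = massFunctional M`:
`P_{m₁ + M} ∘ R = P_{m₁}`, and `R φ = φ` outside `J⁺(supp Q)`. -/
structure IsMollerMap (m₁ : Config) (M : TestFun) (R : Config → Config) : Prop where
  intertwines : ∀ φ, kleinGordon (m₁ + M) (R φ) = kleinGordon m₁ φ
  eq_outside : ∀ φ, ∀ x ∉ causalFuture (functionalSupport (massFunctional M)), R φ x = φ x

/-- The operator `r = -Δᴿ ∘ Q⁽¹⁾` on configurations. -/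
def neumannOp (G : TestFun →ₗ[ℝ] Config) (M : TestFun) : Module.End ℝ Config :=
  -(G ∘ₗ massDeriv M)

end

/-! ### Partial derivatives and the Klein-Gordon operator -/

section Basics

/-! The proof rests on inverting `P_0 = -□` on functions supported in `J⁺(K)`, `K` compact, with a
norm as small as desired. In three space dimensions the retarded fundamental solution is a positive
measure, a multiple of `dy/|y|` on the light cone `t = |y|`. This is seen by integrating a
divergence over the hyperboloid `t² = |y|² + ε²` and letting `ε → 0` (`integral_cone_kleinGordon`).
The Laplace transform of the measure in `t` is a multiple of `a⁻²`, so convolution with it has norm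
`O(a⁻²)` with respect to the weight `e^{at}`. The same bound holds for derivatives of every order
because `P_0` has constant coefficients (`HasExpBound.of_kleinGordon_zero`).

Multiplication by a smooth mass is bounded on the compact set `J⁺(K) ∩ {t ≤ T}`, uniformly in `a`.
For large `a` every mass term is thus a contractive perturbation. This yields the a priori estimate
`exists_hasExpBound_of_kleinGordon`, hence uniqueness, and the convergence of the Volterra series
that solves the equation for a compactly supported mass. A general mass is cut off, and the
solutions are glued in time.

The Møller map is `R = 1 - Δ₂ᴿ M`. Since `P₁(Rφ - φ) = -M Rφ`, uniqueness gives `Rφ - φ = r(Rφ)`.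
The partial sums telescope to `Rφ - r^N(Rφ)`, and the a priori estimate for `P₁` makes `r^N(Rφ)`
decay geometrically in every seminorm. -/

theorem Config.partialDeriv_apply (v : Minkowski) (φ : Config) (x : Minkowski) :
    Config.partialDeriv v φ x = fderiv ℝ φ x v := rfl

theorem Config.differentiable (φ : Config) : Differentiable ℝ φ :=
  φ.contDiff.differentiable (by simp)

theorem Config.continuous (φ : Config) : Continuous φ := φ.contDiff.continuous

theorem kleinGordon_apply (m φ : Config) (x : Minkowski) :
    kleinGordon m φ x = Config.partialDeriv timeDir (Config.partialDeriv timeDir φ) x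
      - ∑ i : Fin 3, Config.partialDeriv (spaceDir i) (Config.partialDeriv (spaceDir i) φ) x
      + m x * φ x := by
  have hs : ∀ (s : Finset (Fin 3)) (f : Fin 3 → Config),
      (∑ i ∈ s, f i : Config) x = ∑ i ∈ s, f i x := fun s f => by
    classical
    induction s using Finset.induction_on with
    | empty => simp
    | insert a s ha ih =>
      rw [Finset.sum_insert ha, Finset.sum_insert ha, ← ih]; rfl
  simp only [kleinGordon, dAlembert, LinearMap.add_apply, LinearMap.neg_apply,
    LinearMap.sum_apply, LinearMap.comp_apply, LinearMap.mulLeft_apply]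
  change -(-Config.partialDeriv timeDir (Config.partialDeriv timeDir φ) x + (∑ i : Fin 3,
    Config.partialDeriv (spaceDir i) (Config.partialDeriv (spaceDir i) φ) : Config) x)
    + m x * φ x = _
  rw [hs]
  ring

theorem Config.partialDeriv_comm (v w : Minkowski) (φ : Config) :
    Config.partialDeriv v (Config.partialDeriv w φ) =
      Config.partialDeriv w (Config.partialDeriv v φ) := by
  ext x
  have hd : DifferentiableAt ℝ (fderiv ℝ φ) x :=
    (φ.contDiff.fderiv_right (m := ∞) (mod_cast le_top)).differentiable (by simp) x
  have key (a b : Minkowski) : Config.partialDeriv a (Config.partialDeriv b φ) x =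
      fderiv ℝ (fderiv ℝ φ) x a b := by
    change fderiv ℝ (fun y => fderiv ℝ φ y b) x a = _
    rw [fderiv_clm_apply hd (differentiableAt_const b)]
    simp
  rw [key, key]
  exact second_derivative_symmetric (f := φ) (fun y => (φ.differentiable y).hasFDerivAt)
    hd.hasFDerivAt v w

/-- Constant coefficients: this is what carries the order-zero representation formula over to all
derivatives. -/
theorem Config.partialDeriv_kleinGordon_zero (v : Minkowski) (φ : Config) :
    Config.partialDeriv v (kleinGordon 0 φ) = kleinGordon 0 (Config.partialDeriv v φ) := by
  have h (w : Minkowski) : Config.partialDeriv v (Config.partialDeriv w (Config.partialDeriv w φ))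
      = Config.partialDeriv w (Config.partialDeriv w (Config.partialDeriv v φ)) := by
    rw [Config.partialDeriv_comm v w, Config.partialDeriv_comm v w]
  simp only [kleinGordon, dAlembert, LinearMap.add_apply, LinearMap.neg_apply,
    LinearMap.sum_apply, LinearMap.comp_apply, LinearMap.mulLeft_apply, map_add, map_neg, map_sum,
    h, zero_mul, map_zero]

theorem Config.partialDeriv_eventuallyEq {φ ψ : Config} {x : Minkowski}
    (h : (φ : Minkowski → ℝ) =ᶠ[𝓝 x] ψ) (v : Minkowski) :
    (Config.partialDeriv v φ : Minkowski → ℝ) =ᶠ[𝓝 x] Config.partialDeriv v ψ :=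
  (h.fderiv (𝕜 := ℝ)).mono fun _ hy => congrArg (fun L : Minkowski →L[ℝ] ℝ => L v) hy

/-- Locality, used whenever a configuration is cut off or glued. -/
theorem kleinGordon_eventuallyEq (m : Config) {φ ψ : Config} {x : Minkowski}
    (h : (φ : Minkowski → ℝ) =ᶠ[𝓝 x] ψ) :
    kleinGordon m φ x = kleinGordon m ψ x := by
  have h2 (v : Minkowski) := (Config.partialDeriv_eventuallyEq
    (Config.partialDeriv_eventuallyEq h v) v).eq_of_nhds
  simp only [kleinGordon_apply, h2, h.eq_of_nhds]

theorem kleinGordon_eq_zero_add (m φ : Config) :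
    kleinGordon m φ = kleinGordon 0 φ + m * φ := by
  simp [kleinGordon]

theorem fderiv_apply_spaceDir (φ : Config) (x : Minkowski) (a : ℝ) (i : Fin 3) :
    fderiv ℝ φ x (a, EuclideanSpace.single i 1) =
      a * Config.partialDeriv timeDir φ x + Config.partialDeriv (spaceDir i) φ x := by
  have : ((a, EuclideanSpace.single i 1) : Minkowski) = a • timeDir + spaceDir i := by
    simp [timeDir, spaceDir]
  rw [this, map_add, map_smul]
  rfl

end Basics

/-! ### The fundamental solution of the wave equation -/

section Hyperboloid

/-- The time coordinate on the upper sheet of the hyperboloid `t² - |y|² = ε²`. -/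
noncomputable def hypTime (ε : ℝ) (y : EuclideanSpace ℝ (Fin 3)) : ℝ := √(‖y‖ ^ 2 + ε ^ 2)

theorem hypTime_pos {ε : ℝ} (hε : 0 < ε) (y : EuclideanSpace ℝ (Fin 3)) : 0 < hypTime ε y :=
  Real.sqrt_pos.2 (by positivity)

theorem hypTime_sq (ε : ℝ) (y : EuclideanSpace ℝ (Fin 3)) :
    hypTime ε y ^ 2 = ‖y‖ ^ 2 + ε ^ 2 := Real.sq_sqrt (by positivity)

theorem norm_le_hypTime (ε : ℝ) (y : EuclideanSpace ℝ (Fin 3)) : ‖y‖ ≤ hypTime ε y :=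
  Real.le_sqrt_of_sq_le (by nlinarith [sq_nonneg ε])

theorem le_hypTime (ε : ℝ) (y : EuclideanSpace ℝ (Fin 3)) : ε ≤ hypTime ε y :=
  Real.le_sqrt_of_sq_le (by nlinarith [sq_nonneg ‖y‖])

theorem continuous_hypTime (ε : ℝ) : Continuous (hypTime ε) := by
  unfold hypTime; fun_prop

theorem hasLineDerivAt_hypTime {ε : ℝ} (hε : 0 < ε) (y : EuclideanSpace ℝ (Fin 3)) (i : Fin 3) :
    HasLineDerivAt ℝ (hypTime ε) (y i / hypTime ε y) y (EuclideanSpace.single i 1) := by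
  have hl : HasDerivAt (fun s : ℝ => y + s • EuclideanSpace.single i (1 : ℝ))
      (EuclideanSpace.single i 1) 0 := by
    simpa using ((hasDerivAt_id (0 : ℝ)).smul_const (EuclideanSpace.single i (1 : ℝ))).const_add y
  have h2 := (hl.norm_sq.add_const (ε ^ 2)).sqrt (by simp; positivity)
  refine h2.congr_deriv ?_
  simp [EuclideanSpace.inner_single_right, hypTime]
  ring

theorem hasLineDerivAt_comp_hypTime {ε : ℝ} (hε : 0 < ε) (φ : Config)
    (y : EuclideanSpace ℝ (Fin 3)) (i : Fin 3) :
    HasLineDerivAt ℝ (fun y => φ (hypTime ε y, y))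
      (y i / hypTime ε y * Config.partialDeriv timeDir φ (hypTime ε y, y)
        + Config.partialDeriv (spaceDir i) φ (hypTime ε y, y)) y (EuclideanSpace.single i 1) := by
  have hl : HasDerivAt (fun s : ℝ => y + s • EuclideanSpace.single i (1 : ℝ))
      (EuclideanSpace.single i 1) 0 := by
    simpa using ((hasDerivAt_id (0 : ℝ)).smul_const (EuclideanSpace.single i (1 : ℝ))).const_add y
  have h1 : HasDerivAt (fun s : ℝ => ((hypTime ε (y + s • EuclideanSpace.single i (1 : ℝ)),
      y + s • EuclideanSpace.single i (1 : ℝ)) : Minkowski))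
      (y i / hypTime ε y, EuclideanSpace.single i 1) 0 :=
    (hasLineDerivAt_hypTime hε y i).prodMk hl
  have h2 := HasFDerivAt.comp_hasDerivAt_of_eq (0 : ℝ)
    (φ.differentiable (hypTime ε y, y)).hasFDerivAt h1 (by simp)
  rw [← fderiv_apply_spaceDir]
  exact h2

theorem hasLineDerivAt_coord (y : EuclideanSpace ℝ (Fin 3)) (i : Fin 3) :
    HasLineDerivAt ℝ (fun y : EuclideanSpace ℝ (Fin 3) => y i) 1 y
      (EuclideanSpace.single i 1) := by
  have : HasDerivAt (fun s : ℝ => y i + s * 1) 1 0 := by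
    simpa using ((hasDerivAt_id (0 : ℝ)).mul_const 1).const_add (y i)
  simpa [HasLineDerivAt] using this

/-- The `i`-th component of the vector field on the hyperboloid whose divergence relates the wave
operator to the fundamental solution. -/
noncomputable def hypField (ε : ℝ) (φ : Config) (i : Fin 3) (y : EuclideanSpace ℝ (Fin 3)) : ℝ :=
  -Config.partialDeriv (spaceDir i) φ (hypTime ε y, y) / hypTime ε y
    + Config.partialDeriv timeDir φ (hypTime ε y, y) * y i / hypTime ε y ^ 2
    - φ (hypTime ε y, y) * y i / hypTime ε y ^ 3

/-- The derivative of the `i`-th component of `hypField` in the `i`-th direction. -/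
noncomputable def hypFieldDeriv (ε : ℝ) (φ : Config) (i : Fin 3)
    (y : EuclideanSpace ℝ (Fin 3)) : ℝ :=
  -Config.partialDeriv (spaceDir i) (Config.partialDeriv (spaceDir i) φ) (hypTime ε y, y)
      / hypTime ε y
    + Config.partialDeriv timeDir (Config.partialDeriv timeDir φ) (hypTime ε y, y) * y i ^ 2
      / hypTime ε y ^ 3
    + Config.partialDeriv timeDir φ (hypTime ε y, y)
      * (1 / hypTime ε y ^ 2 - 3 * y i ^ 2 / hypTime ε y ^ 4)
    + φ (hypTime ε y, y) * (3 * y i ^ 2 / hypTime ε y ^ 5 - 1 / hypTime ε y ^ 3)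

theorem hasLineDerivAt_hypField {ε : ℝ} (hε : 0 < ε) (φ : Config) (i : Fin 3)
    (y : EuclideanSpace ℝ (Fin 3)) :
    HasLineDerivAt ℝ (hypField ε φ i) (hypFieldDeriv ε φ i y) y (EuclideanSpace.single i 1) := by
  have hρ : hypTime ε y ≠ 0 := (hypTime_pos hε y).ne'
  have dρ := hasLineDerivAt_hypTime hε y i
  have d0 := hasLineDerivAt_comp_hypTime hε φ y i
  have dt := hasLineDerivAt_comp_hypTime hε (Config.partialDeriv timeDir φ) y i
  have di := hasLineDerivAt_comp_hypTime hε (Config.partialDeriv (spaceDir i) φ) y i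
  have dc := hasLineDerivAt_coord y i
  -- With the mixed derivatives in one order, the first two terms of the field contribute them with
  -- coefficients `∓ y i / ρ²`, where `ρ = hypTime ε y`, and they cancel. The `∂_i φ` terms of the
  -- first and third summands cancel as well.
  rw [Config.partialDeriv_comm timeDir (spaceDir i)] at di
  unfold HasLineDerivAt at *
  have e := ((di.neg.div dρ (by simpa using hρ)).add
    ((dt.mul dc).div (dρ.pow 2) (by simpa using hρ))).sub
    ((d0.mul dc).div (dρ.pow 3) (by simpa using hρ))
  refine e.congr_deriv ?_
  simp only [hypFieldDeriv, zero_smul, add_zero, Pi.mul_apply, Pi.pow_apply, Pi.neg_apply]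
  field_simp
  ring

/-- Substituting `|y|² = ρ² - ε²`, with `ρ = hypTime ε y`, completes the wave operator with weight
`1/ρ`. In dimension three the leading parts of the coefficients of `∂_t φ` and `φ` cancel, so
everything else carries a factor `ε²`. -/
theorem sum_hypFieldDeriv {ε : ℝ} (hε : 0 < ε) (φ : Config) (y : EuclideanSpace ℝ (Fin 3)) :
    ∑ i, hypFieldDeriv ε φ i y =
      kleinGordon 0 φ (hypTime ε y, y) / hypTime ε y
      - ε ^ 2 * Config.partialDeriv timeDir (Config.partialDeriv timeDir φ) (hypTime ε y, y)
        / hypTime ε y ^ 3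
      + 3 * ε ^ 2 * Config.partialDeriv timeDir φ (hypTime ε y, y) / hypTime ε y ^ 4
      - 3 * ε ^ 2 * φ (hypTime ε y, y) / hypTime ε y ^ 5 := by
  have hρ : hypTime ε y ≠ 0 := (hypTime_pos hε y).ne'
  have hn : y 0 ^ 2 + y 1 ^ 2 + y 2 ^ 2 = hypTime ε y ^ 2 - ε ^ 2 := by
    rw [hypTime_sq, EuclideanSpace.norm_sq_eq]
    simp [Fin.sum_univ_three]
  rw [kleinGordon_apply]
  simp only [hypFieldDeriv, Fin.sum_univ_three]
  have h0 : ((0 : Config) : Minkowski → ℝ) (hypTime ε y, y) = 0 := rfl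
  rw [h0]
  have hn' : y 0 ^ 2 = hypTime ε y ^ 2 - ε ^ 2 - y 1 ^ 2 - y 2 ^ 2 := by linarith
  rw [hn']
  field_simp
  ring

end Hyperboloid

/-! ### Shrinking the hyperboloid to the light cone -/

section ConeIdentity

theorem tsupport_partialDeriv_subset (v : Minkowski) (φ : Config) :
    tsupport (Config.partialDeriv v φ) ⊆ tsupport φ :=
  tsupport_fderiv_apply_subset ℝ v

theorem exists_bound_of_mem_testFun {φ : Config} (hφ : φ ∈ TestFun) :
    ∃ B, 0 ≤ B ∧ ∀ z, |φ z| ≤ B := by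
  obtain ⟨B, hB⟩ := HasCompactSupport.exists_bound_of_continuous hφ φ.continuous
  exact ⟨B, (norm_nonneg _).trans (hB 0), hB⟩

theorem exists_radius_of_mem_testFun {φ : Config} (hφ : φ ∈ TestFun) :
    ∃ r, ∀ z ∈ tsupport φ, ‖z‖ < r := by
  obtain ⟨r, hr⟩ := (IsCompact.isBounded hφ).subset_ball 0
  exact ⟨r, fun z hz => by simpa using hr hz⟩

theorem continuous_comp_hypTime (ε : ℝ) (φ : Config) :
    Continuous fun y => φ (hypTime ε y, y) :=
  φ.continuous.comp ((continuous_hypTime ε).prodMk continuous_id)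

theorem continuous_hypField {ε : ℝ} (hε : 0 < ε) (φ : Config) (i : Fin 3) :
    Continuous (hypField ε φ i) := by
  have h0 := continuous_comp_hypTime ε φ
  have ht := continuous_comp_hypTime ε (Config.partialDeriv timeDir φ)
  have hi := continuous_comp_hypTime ε (Config.partialDeriv (spaceDir i) φ)
  have hρ := continuous_hypTime ε
  have hne : ∀ y, hypTime ε y ≠ 0 := fun y => (hypTime_pos hε y).ne'
  unfold hypField
  exact ((hi.neg.div hρ hne).add ((ht.mul (by fun_prop)).div (hρ.pow 2) (by simp [hne]))).sub
    ((h0.mul (by fun_prop)).div (hρ.pow 3) (by simp [hne]))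

theorem continuous_hypFieldDeriv {ε : ℝ} (hε : 0 < ε) (φ : Config) (i : Fin 3) :
    Continuous (hypFieldDeriv ε φ i) := by
  have h0 := continuous_comp_hypTime ε φ
  have ht := continuous_comp_hypTime ε (Config.partialDeriv timeDir φ)
  have htt := continuous_comp_hypTime ε (Config.partialDeriv timeDir
    (Config.partialDeriv timeDir φ))
  have hii := continuous_comp_hypTime ε (Config.partialDeriv (spaceDir i)
    (Config.partialDeriv (spaceDir i) φ))
  have hρ := continuous_hypTime ε
  have hne : ∀ y, hypTime ε y ≠ 0 := fun y => (hypTime_pos hε y).ne'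
  have hc : Continuous fun y : EuclideanSpace ℝ (Fin 3) => y i ^ 2 := by fun_prop
  unfold hypFieldDeriv
  exact (((hii.neg.div hρ hne).add ((htt.mul hc).div (hρ.pow 3) (by simp [hne]))).add
    (ht.mul ((continuous_const.div (hρ.pow 2) (by simp [hne])).sub
      ((continuous_const.mul hc).div (hρ.pow 4) (by simp [hne]))))).add
    (h0.mul (((continuous_const.mul hc).div (hρ.pow 5) (by simp [hne])).sub
      (continuous_const.div (hρ.pow 3) (by simp [hne]))))

theorem apply_eq_zero_of_radius_le {φ : Config} {r : ℝ} (hr : ∀ z ∈ tsupport φ, ‖z‖ < r)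
    (t : ℝ) {y : EuclideanSpace ℝ (Fin 3)} (hy : r ≤ ‖y‖) : φ (t, y) = 0 := by
  by_contra h
  have h1 := hr _ (subset_tsupport _ h)
  have h2 : ‖y‖ ≤ ‖((t, y) : Minkowski)‖ := norm_snd_le (t, y)
  linarith

theorem radius_partialDeriv {φ : Config} {r : ℝ} (hr : ∀ z ∈ tsupport φ, ‖z‖ < r)
    (v : Minkowski) : ∀ z ∈ tsupport (Config.partialDeriv v φ), ‖z‖ < r :=
  fun z hz => hr z (tsupport_partialDeriv_subset v φ hz)

theorem integrable_hypFieldDeriv {ε : ℝ} (hε : 0 < ε) {φ : Config} (hφ : φ ∈ TestFun)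
    (i : Fin 3) : Integrable (hypFieldDeriv ε φ i) := by
  obtain ⟨r, hr⟩ := exists_radius_of_mem_testFun hφ
  refine (continuous_hypFieldDeriv hε φ i).integrable_of_hasCompactSupport
    (HasCompactSupport.intro (isCompact_closedBall 0 r) fun y hy => ?_)
  have hy' : r ≤ ‖y‖ := by simpa using (not_le.1 (by simpa using hy)).le
  have ht := radius_partialDeriv hr timeDir
  have hi := radius_partialDeriv hr (spaceDir i)
  simp [hypFieldDeriv, apply_eq_zero_of_radius_le hr _ hy', apply_eq_zero_of_radius_le ht _ hy',
    apply_eq_zero_of_radius_le (radius_partialDeriv ht timeDir) _ hy',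
    apply_eq_zero_of_radius_le (radius_partialDeriv hi (spaceDir i)) _ hy']

theorem integral_hypFieldDeriv {ε : ℝ} (hε : 0 < ε) {φ : Config} (hφ : φ ∈ TestFun)
    (i : Fin 3) : ∫ y, hypFieldDeriv ε φ i y = 0 := by
  obtain ⟨r, hr⟩ := exists_radius_of_mem_testFun hφ
  have hint : Integrable (hypField ε φ i) := by
    refine (continuous_hypField hε φ i).integrable_of_hasCompactSupport
      (HasCompactSupport.intro (isCompact_closedBall 0 r) fun y hy => ?_)
    have hy' : r ≤ ‖y‖ := by simpa using (not_le.1 (by simpa using hy)).le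
    simp [hypField, apply_eq_zero_of_radius_le hr _ hy',
      apply_eq_zero_of_radius_le (radius_partialDeriv hr timeDir) _ hy',
      apply_eq_zero_of_radius_le (radius_partialDeriv hr (spaceDir i)) _ hy']
  -- Integration by parts against the constant function 1.
  have h := integral_bilinear_hasLineDerivAt_right_eq_neg_left_of_integrable
    (μ := (volume : Measure (EuclideanSpace ℝ (Fin 3))))
    (f := fun _ => (1 : ℝ)) (f' := fun _ => 0) (g := hypField ε φ i)
    (g' := hypFieldDeriv ε φ i) (v := EuclideanSpace.single i 1)
    (B := ContinuousLinearMap.mul ℝ ℝ) (by simp)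
    (by simpa using integrable_hypFieldDeriv hε hφ i) (by simpa using hint)
    (fun x _ => by simp [HasLineDerivAt, hasDerivAt_const])
    (fun x _ => hasLineDerivAt_hypField hε φ i x)
  simpa using h

/-- The normalisation constant of the fundamental solution of the wave equation. -/
noncomputable def coneConst : ℝ :=
  ∫ w : EuclideanSpace ℝ (Fin 3), 3 * (1 + ‖w‖ ^ 2) ^ (-5 / 2 : ℝ)

theorem integrable_coneConst :
    Integrable fun w : EuclideanSpace ℝ (Fin 3) => 3 * (1 + ‖w‖ ^ 2) ^ (-5 / 2 : ℝ) :=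
  (integrable_rpow_neg_one_add_norm_sq (r := 5) (by simp; norm_num)).const_mul 3

theorem coneConst_pos : 0 < coneConst := by
  refine (integral_pos_iff_support_of_nonneg (fun w => ?_) integrable_coneConst).2 ?_
  · simp only [Pi.zero_apply]; positivity
  · have : Function.support (fun w : EuclideanSpace ℝ (Fin 3) =>
        3 * (1 + ‖w‖ ^ 2) ^ (-5 / 2 : ℝ)) = Set.univ := by
      ext w
      have : 0 < 3 * (1 + ‖w‖ ^ 2) ^ (-5 / 2 : ℝ) := by positivity
      exact ⟨fun _ => trivial, fun _ => this.ne'⟩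
    rw [this]
    simp

theorem hypTime_smul {ε : ℝ} (hε : 0 < ε) (w : EuclideanSpace ℝ (Fin 3)) :
    hypTime ε (ε • w) = ε * hypTime 1 w := by
  unfold hypTime
  rw [norm_smul, Real.norm_eq_abs, abs_of_pos hε,
    show (ε * ‖w‖) ^ 2 + ε ^ 2 = ε ^ 2 * (‖w‖ ^ 2 + 1 ^ 2) by ring, Real.sqrt_mul (by positivity),
    Real.sqrt_sq hε.le]

/-- The substitution `y = ε w` produces `ε² · ε³ / ε⁵ = 1`: the term keeps its mass and concentrates
at the origin as `ε → 0`. -/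
theorem integral_concentrating {ε : ℝ} (hε : 0 < ε) (φ : Config) :
    ∫ y, 3 * ε ^ 2 * φ (hypTime ε y, y) / hypTime ε y ^ 5 =
      ∫ w : EuclideanSpace ℝ (Fin 3), 3 * (1 + ‖w‖ ^ 2) ^ (-5 / 2 : ℝ)
        * φ (ε * hypTime 1 w, ε • w) := by
  have h := Measure.integral_comp_smul_of_nonneg
    (volume : Measure (EuclideanSpace ℝ (Fin 3)))
    (fun y => 3 * ε ^ 2 * φ (hypTime ε y, y) / hypTime ε y ^ 5) ε (hR := hε.le)
  rw [eq_comm, inv_smul_eq_iff₀ (by positivity)] at h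
  rw [h, ← integral_smul]
  congr 1
  ext w
  have hp := hypTime_pos one_pos w
  have : (1 + ‖w‖ ^ 2) ^ (-5 / 2 : ℝ) = (hypTime 1 w ^ 5)⁻¹ := by
    have e : (1 + ‖w‖ ^ 2) = hypTime 1 w ^ (2 : ℝ) := by
      rw [Real.rpow_ofNat, hypTime_sq]; ring
    rw [e, ← Real.rpow_mul hp.le, ← Real.rpow_natCast, ← Real.rpow_neg hp.le]
    norm_num
  rw [hypTime_smul hε, this, finrank_euclideanSpace_fin, smul_eq_mul]
  field_simp

theorem tendsto_integral_concentrating {φ : Config} (hφ : φ ∈ TestFun) :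
    Tendsto (fun ε : ℝ => ∫ y, 3 * ε ^ 2 * φ (hypTime ε y, y) / hypTime ε y ^ 5) (𝓝[>] 0)
      (𝓝 (coneConst * φ 0)) := by
  obtain ⟨B, hB0, hB⟩ := exists_bound_of_mem_testFun hφ
  have hev : (fun ε : ℝ => ∫ w : EuclideanSpace ℝ (Fin 3), 3 * (1 + ‖w‖ ^ 2) ^ (-5 / 2 : ℝ)
        * φ (ε * hypTime 1 w, ε • w)) =ᶠ[𝓝[>] 0]
      fun ε : ℝ => ∫ y, 3 * ε ^ 2 * φ (hypTime ε y, y) / hypTime ε y ^ 5 := by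
    filter_upwards [self_mem_nhdsWithin] with ε hε
    exact (integral_concentrating hε φ).symm
  refine Tendsto.congr' hev ?_
  rw [coneConst, ← integral_mul_const]
  refine tendsto_integral_filter_of_dominated_convergence
    (fun w => 3 * (1 + ‖w‖ ^ 2) ^ (-5 / 2 : ℝ) * B) ?_ ?_ (integrable_coneConst.mul_const B) ?_
  · refine Eventually.of_forall fun ε => ?_
    refine integrable_coneConst.aestronglyMeasurable.mul (Continuous.aestronglyMeasurable ?_)
    exact φ.continuous.comp ((continuous_const.mul (continuous_hypTime 1)).prodMk
      (continuous_const_smul ε))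
  · refine Eventually.of_forall fun ε => Eventually.of_forall fun w => ?_
    rw [norm_mul, Real.norm_of_nonneg (by positivity)]
    exact mul_le_mul_of_nonneg_left (hB _) (by positivity)
  · refine Eventually.of_forall fun w => Tendsto.const_mul _ ?_
    have hc : Continuous fun ε : ℝ => φ (ε * hypTime 1 w, ε • w) :=
      φ.continuous.comp ((continuous_id.mul continuous_const).prodMk
        (continuous_id.smul continuous_const))
    have h0 : (((0 : ℝ) * hypTime 1 w, (0 : ℝ) • w) : Minkowski) = 0 := by simp
    have := (hc.tendsto 0).mono_left (nhdsWithin_le_nhds (s := Set.Ioi 0))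
    rwa [h0] at this

/-- In polar coordinates the Jacobian `s²` absorbs the singularity. This and the next lemma make the
majorant of `hypRemainder` integrable. -/
theorem integrableOn_inv_norm (r : ℝ) :
    IntegrableOn (fun y : EuclideanSpace ℝ (Fin 3) => ‖y‖⁻¹) (Metric.ball 0 r) := by
  refine (integrableOn_fun_norm_addHaar (f := fun s : ℝ => s⁻¹) volume).2 ?_
  have : IntegrableOn (fun s : ℝ => s) (Set.Ioo 0 r) :=
    (continuous_id.integrableOn_Icc (a := 0) (b := r)).mono_set Set.Ioo_subset_Icc_self
  refine this.congr_fun (fun s hs => ?_) measurableSet_Ioo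
  have := hs.1.ne'
  simp only [finrank_euclideanSpace_fin, smul_eq_mul]
  field_simp

theorem integrableOn_inv_norm_sq (r : ℝ) :
    IntegrableOn (fun y : EuclideanSpace ℝ (Fin 3) => (‖y‖ ^ 2)⁻¹) (Metric.ball 0 r) := by
  refine (integrableOn_fun_norm_addHaar (f := fun s : ℝ => (s ^ 2)⁻¹) volume).2 ?_
  have : IntegrableOn (fun s : ℝ => (1 : ℝ)) (Set.Ioo 0 r) := by simp
  refine this.congr_fun (fun s hs => ?_) measurableSet_Ioo
  have := hs.1.ne'
  simp only [finrank_euclideanSpace_fin, smul_eq_mul]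
  field_simp

/-- The remainder of the divergence identity after splitting off the concentrating term. -/
noncomputable def hypRemainder (ε : ℝ) (φ : Config) (y : EuclideanSpace ℝ (Fin 3)) : ℝ :=
  kleinGordon 0 φ (hypTime ε y, y) / hypTime ε y
    - ε ^ 2 * Config.partialDeriv timeDir (Config.partialDeriv timeDir φ) (hypTime ε y, y)
      / hypTime ε y ^ 3
    + 3 * ε ^ 2 * Config.partialDeriv timeDir φ (hypTime ε y, y) / hypTime ε y ^ 4

theorem integral_hypRemainder {ε : ℝ} (hε : 0 < ε) {φ : Config} (hφ : φ ∈ TestFun) :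
    ∫ y, hypRemainder ε φ y = ∫ y, 3 * ε ^ 2 * φ (hypTime ε y, y) / hypTime ε y ^ 5 := by
  obtain ⟨r, hr⟩ := exists_radius_of_mem_testFun hφ
  have hi : Integrable fun y => 3 * ε ^ 2 * φ (hypTime ε y, y) / hypTime ε y ^ 5 := by
    refine Continuous.integrable_of_hasCompactSupport ?_
      (HasCompactSupport.intro (isCompact_closedBall 0 r) fun y hy => ?_)
    · exact (continuous_const.mul (continuous_comp_hypTime ε φ)).div
        ((continuous_hypTime ε).pow 5) fun y => pow_ne_zero _ (hypTime_pos hε y).ne'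
    · have hy' : r ≤ ‖y‖ := by simpa using (not_le.1 (by simpa using hy)).le
      simp [apply_eq_zero_of_radius_le hr _ hy']
  have hs : (fun y => hypRemainder ε φ y) = fun y => (∑ i, hypFieldDeriv ε φ i y)
      + 3 * ε ^ 2 * φ (hypTime ε y, y) / hypTime ε y ^ 5 := by
    ext y
    rw [sum_hypFieldDeriv hε, hypRemainder]
    ring
  rw [hs, integral_add (integrable_finsetSum _ fun i _ => integrable_hypFieldDeriv hε hφ i) hi,
    integral_finsetSum _ fun i _ => integrable_hypFieldDeriv hε hφ i]
  simp [integral_hypFieldDeriv hε hφ]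

/-- Since both `ε` and `‖y‖` are at most `hypTime ε y`, each `ε²` pays for two powers of the
denominator, which leaves a majorant independent of `ε`. -/
theorem norm_hypRemainder_le {ε : ℝ} (hε : 0 < ε) {φ : Config} {B₀ B₁ B₂ : ℝ}
    (h₀ : ∀ z, |kleinGordon 0 φ z| ≤ B₀)
    (h₁ : ∀ z, |Config.partialDeriv timeDir φ z| ≤ B₁)
    (h₂ : ∀ z, |Config.partialDeriv timeDir (Config.partialDeriv timeDir φ) z| ≤ B₂)
    {y : EuclideanSpace ℝ (Fin 3)} (hy : y ≠ 0) :
    ‖hypRemainder ε φ y‖ ≤ (B₀ + B₂) * ‖y‖⁻¹ + 3 * B₁ * (‖y‖ ^ 2)⁻¹ := by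
  have hp := hypTime_pos hε y
  have hny : 0 < ‖y‖ := norm_pos_iff.2 hy
  have hle := norm_le_hypTime ε y
  have hεle := le_hypTime ε y
  have B₀p := (abs_nonneg _).trans (h₀ 0)
  have B₁p := (abs_nonneg _).trans (h₁ 0)
  have B₂p := (abs_nonneg _).trans (h₂ 0)
  have e : ε ^ 2 ≤ hypTime ε y ^ 2 := pow_le_pow_left₀ hε.le hεle 2
  have hinv : (hypTime ε y)⁻¹ ≤ ‖y‖⁻¹ := inv_anti₀ hny hle
  have hinv2 : (hypTime ε y ^ 2)⁻¹ ≤ (‖y‖ ^ 2)⁻¹ :=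
    inv_anti₀ (by positivity) (pow_le_pow_left₀ hny.le hle 2)
  have a3 : ε ^ 2 / hypTime ε y ^ 3 ≤ ‖y‖⁻¹ := by
    refine le_trans ?_ hinv
    rw [div_le_iff₀ (by positivity)]
    refine e.trans (le_of_eq ?_)
    field_simp
  have a4 : ε ^ 2 / hypTime ε y ^ 4 ≤ (‖y‖ ^ 2)⁻¹ := by
    refine le_trans ?_ hinv2
    rw [div_le_iff₀ (by positivity)]
    refine e.trans (le_of_eq ?_)
    field_simp
  have t1 : ‖kleinGordon 0 φ (hypTime ε y, y) / hypTime ε y‖ ≤ B₀ * ‖y‖⁻¹ := by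
    rw [norm_div, Real.norm_of_nonneg hp.le, div_eq_mul_inv]
    exact mul_le_mul (h₀ _) hinv (by positivity) B₀p
  have t2 : ‖ε ^ 2 * Config.partialDeriv timeDir (Config.partialDeriv timeDir φ) (hypTime ε y, y)
      / hypTime ε y ^ 3‖ ≤ B₂ * ‖y‖⁻¹ := by
    rw [mul_comm, mul_div_assoc, norm_mul, Real.norm_of_nonneg (r := ε ^ 2 / _) (by positivity)]
    exact mul_le_mul (h₂ _) a3 (by positivity) B₂p
  have t3 : ‖3 * ε ^ 2 * Config.partialDeriv timeDir φ (hypTime ε y, y) / hypTime ε y ^ 4‖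
      ≤ 3 * B₁ * (‖y‖ ^ 2)⁻¹ := by
    rw [show 3 * ε ^ 2 * Config.partialDeriv timeDir φ (hypTime ε y, y) / hypTime ε y ^ 4
      = 3 * Config.partialDeriv timeDir φ (hypTime ε y, y) * (ε ^ 2 / hypTime ε y ^ 4) by ring,
      norm_mul, norm_mul, Real.norm_of_nonneg (r := ε ^ 2 / _) (by positivity)]
    refine mul_le_mul ?_ a4 (by positivity) (by positivity)
    simpa using h₁ _
  calc _ ≤ _ := norm_add_le _ _
    _ ≤ _ := add_le_add (norm_sub_le _ _) le_rfl
    _ ≤ (B₀ * ‖y‖⁻¹ + B₂ * ‖y‖⁻¹) + 3 * B₁ * (‖y‖ ^ 2)⁻¹ := add_le_add (add_le_add t1 t2) t3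
    _ = _ := by ring

theorem kleinGordon_eq_zero_of_notMem_tsupport (m : Config) {φ : Config} {z : Minkowski}
    (hz : z ∉ tsupport φ) : kleinGordon m φ z = 0 := by
  have h0 : (φ : Minkowski → ℝ) =ᶠ[𝓝 z] (0 : Config) :=
    notMem_tsupport_iff_eventuallyEq.1 hz
  rw [kleinGordon_eventuallyEq m h0, map_zero]
  rfl

theorem tendsto_hypTime (y : EuclideanSpace ℝ (Fin 3)) :
    Tendsto (fun ε : ℝ => hypTime ε y) (𝓝[>] 0) (𝓝 ‖y‖) := by
  have hc : Continuous fun ε : ℝ => hypTime ε y := by unfold hypTime; fun_prop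
  have := (hc.tendsto 0).mono_left (nhdsWithin_le_nhds (s := Set.Ioi 0))
  simpa [hypTime] using this

theorem tendsto_hypRemainder (φ : Config) {y : EuclideanSpace ℝ (Fin 3)} (hy : y ≠ 0) :
    Tendsto (fun ε : ℝ => hypRemainder ε φ y) (𝓝[>] 0)
      (𝓝 (kleinGordon 0 φ (‖y‖, y) / ‖y‖)) := by
  have hny : ‖y‖ ≠ 0 := norm_ne_zero_iff.2 hy
  have hρ := tendsto_hypTime y
  have hψ (ψ : Config) : Tendsto (fun ε : ℝ => ψ (hypTime ε y, y)) (𝓝[>] 0) (𝓝 (ψ (‖y‖, y))) :=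
    (ψ.continuous.tendsto _).comp (hρ.prodMk_nhds tendsto_const_nhds)
  have hε : Tendsto (fun ε : ℝ => ε ^ 2) (𝓝[>] 0) (𝓝 0) := by
    have := ((continuous_pow 2).tendsto (0 : ℝ)).mono_left (nhdsWithin_le_nhds (s := Set.Ioi 0))
    simpa using this
  have := (((hψ (kleinGordon 0 φ)).div hρ hny).sub
    ((hε.mul (hψ (Config.partialDeriv timeDir (Config.partialDeriv timeDir φ)))).div (hρ.pow 3)
      (pow_ne_zero _ hny))).add
    (((hε.const_mul 3).mul (hψ (Config.partialDeriv timeDir φ))).div (hρ.pow 4)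
      (pow_ne_zero _ hny))
  simpa [hypRemainder] using this

/-- The divergence integrates to zero, so the remainder and the concentrating term have equal
integrals for every `ε > 0`. As `ε → 0` the first tends to the cone integral by dominated
convergence, the second to a multiple of the value at the origin. -/
theorem integral_cone_kleinGordon {φ : Config} (hφ : φ ∈ TestFun) :
    ∫ y : EuclideanSpace ℝ (Fin 3), kleinGordon 0 φ (‖y‖, y) / ‖y‖ = coneConst * φ 0 := by
  obtain ⟨r, hr⟩ := exists_radius_of_mem_testFun hφ
  obtain ⟨B₀, -, h₀⟩ := exists_bound_of_mem_testFun (kleinGordon_mem_testFun 0 hφ)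
  have ht := partialDeriv_mem_testFun timeDir hφ
  obtain ⟨B₁, -, h₁⟩ := exists_bound_of_mem_testFun ht
  obtain ⟨B₂, -, h₂⟩ := exists_bound_of_mem_testFun (partialDeriv_mem_testFun timeDir ht)
  refine tendsto_nhds_unique ?_ (tendsto_integral_concentrating hφ)
  have hev : (fun ε : ℝ => ∫ y, hypRemainder ε φ y) =ᶠ[𝓝[>] 0]
      fun ε : ℝ => ∫ y, 3 * ε ^ 2 * φ (hypTime ε y, y) / hypTime ε y ^ 5 := by
    filter_upwards [self_mem_nhdsWithin] with ε hε
    exact integral_hypRemainder hε hφ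
  refine Tendsto.congr' hev ?_
  have hne : ∀ᵐ y : EuclideanSpace ℝ (Fin 3), y ≠ 0 := by simp [ae_iff]
  have hrt := radius_partialDeriv hr timeDir
  refine tendsto_integral_filter_of_dominated_convergence
    ((Metric.ball 0 r).indicator fun y => (B₀ + B₂) * ‖y‖⁻¹ + 3 * B₁ * (‖y‖ ^ 2)⁻¹) ?_ ?_ ?_ ?_
  · filter_upwards [self_mem_nhdsWithin] with ε hε
    have hne' (n : ℕ) (y : EuclideanSpace ℝ (Fin 3)) : hypTime ε y ^ n ≠ 0 :=
      pow_ne_zero _ (hypTime_pos hε y).ne'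
    refine Continuous.aestronglyMeasurable ?_
    exact (((continuous_comp_hypTime ε _).div (continuous_hypTime ε)
      fun y => (hypTime_pos hε y).ne').sub
      ((continuous_const.mul (continuous_comp_hypTime ε _)).div ((continuous_hypTime ε).pow 3)
        (hne' 3))).add ((continuous_const.mul (continuous_comp_hypTime ε _)).div
        ((continuous_hypTime ε).pow 4) (hne' 4))
  · filter_upwards [self_mem_nhdsWithin] with ε hε
    filter_upwards [hne] with y hy
    by_cases hyr : y ∈ Metric.ball 0 r
    · rw [Set.indicator_of_mem hyr]
      exact norm_hypRemainder_le hε h₀ h₁ h₂ hy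
    · rw [Set.indicator_of_notMem hyr]
      have hy' : r ≤ ‖y‖ := by simpa using hyr
      have hk : kleinGordon 0 φ (hypTime ε y, y) = 0 := by
        refine kleinGordon_eq_zero_of_notMem_tsupport 0 fun h => ?_
        have h2 : ‖y‖ ≤ ‖((hypTime ε y, y) : Minkowski)‖ := norm_snd_le (hypTime ε y, y)
        linarith [hr _ h]
      simp [hypRemainder, hk, apply_eq_zero_of_radius_le hrt _ hy',
        apply_eq_zero_of_radius_le (radius_partialDeriv hrt timeDir) _ hy']
  · rw [integrable_indicator_iff measurableSet_ball]
    exact ((integrableOn_inv_norm r).const_mul _).add ((integrableOn_inv_norm_sq r).const_mul _)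
  · filter_upwards [hne] with y hy
    exact tendsto_hypRemainder φ hy

end ConeIdentity

/-! ### The measure on the light cone, its Laplace transform and convolution with it -/

section ConeMeasure

theorem isClosedEmbedding_cone :
    IsClosedEmbedding fun y : EuclideanSpace ℝ (Fin 3) => ((‖y‖, y) : Minkowski) :=
  Function.LeftInverse.isClosedEmbedding (f := Prod.snd) (fun _ => rfl) continuous_snd
    (by fun_prop)

/-- The retarded fundamental solution of the wave equation, a positive measure on the forward
light cone. -/
noncomputable def coneMeasure : Measure Minkowski :=
  ((volume : Measure (EuclideanSpace ℝ (Fin 3))).withDensity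
    fun y => ENNReal.ofReal (coneConst⁻¹ * ‖y‖⁻¹)).map fun y => (‖y‖, y)

theorem integral_coneMeasure (f : Minkowski → ℝ) :
    ∫ w, f w ∂coneMeasure = ∫ y : EuclideanSpace ℝ (Fin 3),
      coneConst⁻¹ * ‖y‖⁻¹ * f (‖y‖, y) := by
  have hc := coneConst_pos
  rw [coneMeasure, isClosedEmbedding_cone.measurableEmbedding.integral_map,
    integral_withDensity_eq_integral_toReal_smul (by fun_prop) (by simp)]
  refine integral_congr_ae (Eventually.of_forall fun y => ?_)
  simp only [smul_eq_mul]
  rw [ENNReal.toReal_ofReal (by positivity)]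

theorem integrable_coneMeasure_iff (f : Minkowski → ℝ) :
    Integrable f coneMeasure ↔ Integrable fun y : EuclideanSpace ℝ (Fin 3) =>
      coneConst⁻¹ * ‖y‖⁻¹ * f (‖y‖, y) := by
  have hc := coneConst_pos
  rw [coneMeasure, isClosedEmbedding_cone.measurableEmbedding.integrable_map_iff,
    integrable_withDensity_iff_integrable_smul' (by fun_prop) (by simp)]
  refine integrable_congr (Eventually.of_forall fun y => ?_)
  simp only [smul_eq_mul, Function.comp_apply]
  rw [ENNReal.toReal_ofReal (by positivity)]

theorem ae_coneMeasure : ∀ᵐ w ∂coneMeasure, ‖w.2‖ ≤ w.1 := by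
  rw [coneMeasure, isClosedEmbedding_cone.measurableEmbedding.ae_map_iff]
  simp

theorem integrable_exp_neg_norm_div {a : ℝ} (ha : 0 < a) :
    Integrable fun y : EuclideanSpace ℝ (Fin 3) => ‖y‖⁻¹ * Real.exp (-(a * ‖y‖)) := by
  refine (integrable_fun_norm_addHaar volume
    (f := fun s : ℝ => s⁻¹ * Real.exp (-(a * s)))).2 ?_
  have := integrableOn_rpow_mul_exp_neg_mul_rpow (p := 1) (s := 1) (b := a) (by norm_num) one_pos ha
  refine this.congr_fun (fun s hs => ?_) measurableSet_Ioi
  have : s ≠ 0 := (Set.mem_Ioi.1 hs).ne'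
  simp only [finrank_euclideanSpace_fin, smul_eq_mul, Real.rpow_one, neg_mul]
  field_simp

theorem integrable_exp_coneMeasure {a : ℝ} (ha : 0 < a) :
    Integrable (fun w : Minkowski => Real.exp (-(a * w.1))) coneMeasure := by
  rw [integrable_coneMeasure_iff]
  simpa only [mul_assoc] using (integrable_exp_neg_norm_div ha).const_mul coneConst⁻¹

/-- Homogeneity: under `y ↦ a y` the density `dy/|y|` scales by `a² = a³/a`. -/
theorem integral_exp_coneMeasure {a : ℝ} (ha : 0 < a) :
    ∫ w : Minkowski, Real.exp (-(a * w.1)) ∂coneMeasure =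
      (a ^ 2)⁻¹ * ∫ w : Minkowski, Real.exp (-w.1) ∂coneMeasure := by
  rw [integral_coneMeasure, integral_coneMeasure]
  have h := Measure.integral_comp_smul_of_nonneg (volume : Measure (EuclideanSpace ℝ (Fin 3)))
    (fun y => coneConst⁻¹ * ‖y‖⁻¹ * Real.exp (-‖y‖)) a (hR := ha.le)
  rw [eq_comm, inv_smul_eq_iff₀ (by positivity)] at h
  simp only at h ⊢
  rw [h, smul_eq_mul, ← mul_assoc, finrank_euclideanSpace_fin, ← integral_const_mul]
  refine integral_congr_ae (Eventually.of_forall fun y => ?_)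
  simp only [norm_smul, Real.norm_of_nonneg ha.le]
  field_simp

/-- The source of every contraction constant below. -/
theorem exists_integral_exp_coneMeasure_le {ε : ℝ} (hε : 0 < ε) :
    ∃ a : ℝ, 0 < a ∧ ∫ w : Minkowski, Real.exp (-(a * w.1)) ∂coneMeasure ≤ ε := by
  have h : Tendsto (fun a : ℝ => (a ^ 2)⁻¹ * ∫ w : Minkowski, Real.exp (-w.1) ∂coneMeasure)
      atTop (𝓝 0) := by
    simpa using (tendsto_inv_atTop_zero.comp (tendsto_pow_atTop two_ne_zero)).mul_const
      (∫ w : Minkowski, Real.exp (-w.1) ∂coneMeasure)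
  obtain ⟨a, ha, h1⟩ := ((eventually_gt_atTop 0).and (h.eventually (gt_mem_nhds hε))).exists
  exact ⟨a, ha, (integral_exp_coneMeasure ha).trans_le h1.le⟩

theorem locallyIntegrable_one_coneMeasure :
    LocallyIntegrable (fun _ : Minkowski => (1 : ℝ)) coneMeasure := by
  have h := (integrable_exp_coneMeasure one_pos).locallyIntegrable
  rw [← locallyIntegrableOn_univ] at h ⊢
  have h2 := h.continuousOn_mul (g := fun w : Minkowski => Real.exp w.1) (by fun_prop)
    isOpen_univ.isLocallyClosed
  refine h2.congr (Eventually.of_forall fun w => ?_)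
  simp [← Real.exp_add]

/-- The configuration `w ↦ φ (z - w)`. -/
noncomputable def Config.reflect (z : Minkowski) (φ : Config) : Config :=
  ⟨fun w => φ (z - w), (φ.contDiff.comp (contDiff_const.sub contDiff_id)).contMDiff⟩

theorem Config.reflect_apply (z : Minkowski) (φ : Config) (w : Minkowski) :
    φ.reflect z w = φ (z - w) := rfl

theorem Config.partialDeriv_reflect (v z : Minkowski) (φ : Config) :
    Config.partialDeriv v (φ.reflect z) = -(Config.partialDeriv v φ).reflect z := by
  ext w
  change fderiv ℝ (fun w => φ (z - w)) w v = -(fderiv ℝ φ (z - w) v)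
  have h : HasFDerivAt (fun w : Minkowski => z - w) (-ContinuousLinearMap.id ℝ Minkowski) w :=
    (hasFDerivAt_id w).const_sub z
  have h2 := (φ.differentiable (z - w)).hasFDerivAt.comp w h
  have h3 : fderiv ℝ (fun w => φ (z - w)) w = _ := h2.fderiv
  rw [h3]
  simp

theorem kleinGordon_reflect (z : Minkowski) (φ : Config) (w : Minkowski) :
    kleinGordon 0 (φ.reflect z) w = kleinGordon 0 φ (z - w) := by
  have h (v : Minkowski) : Config.partialDeriv v (Config.partialDeriv v (φ.reflect z)) w =
      Config.partialDeriv v (Config.partialDeriv v φ) (z - w) := by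
    rw [Config.partialDeriv_reflect, map_neg, Config.partialDeriv_reflect, neg_neg]
    rfl
  rw [kleinGordon_apply, kleinGordon_apply]
  simp only [h]
  congr 1

/-- `P_0` is invariant under translations and, being purely of second order, under `w ↦ -w`. The
identity at the origin therefore applies to the reflected configuration. -/
theorem integral_coneMeasure_kleinGordon {φ : Config} (hφ : φ ∈ TestFun) (z : Minkowski) :
    ∫ w, kleinGordon 0 φ (z - w) ∂coneMeasure = φ z := by
  have hr : φ.reflect z ∈ TestFun :=
    HasCompactSupport.comp_homeomorph (f := φ) hφ (Homeomorph.subLeft z)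
  have h := integral_cone_kleinGordon hr
  rw [integral_coneMeasure]
  have hc := coneConst_pos.ne'
  simp only [kleinGordon_reflect] at h
  have e : (fun y : EuclideanSpace ℝ (Fin 3) => coneConst⁻¹ * ‖y‖⁻¹ *
      kleinGordon 0 φ (z - (‖y‖, y))) = fun y => coneConst⁻¹ *
      (kleinGordon 0 φ (z - (‖y‖, y)) / ‖y‖) := by
    ext y; ring
  rw [e, integral_const_mul, h, Config.reflect_apply, sub_zero]
  field_simp

end ConeMeasure

/-! ### Causal futures -/

section Causal

theorem subset_causalFuture (A : Set Minkowski) : A ⊆ causalFuture A :=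
  fun x hx => ⟨x, hx, by simp⟩

theorem causalFuture_mono {A B : Set Minkowski} (h : A ⊆ B) : causalFuture A ⊆ causalFuture B :=
  fun _ ⟨y, hy, hxy⟩ => ⟨y, h hy, hxy⟩

theorem causalFuture_causalFuture_subset (A : Set Minkowski) :
    causalFuture (causalFuture A) ⊆ causalFuture A := by
  rintro x ⟨y, ⟨z, hz, hyz⟩, hxy⟩
  refine ⟨z, hz, ?_⟩
  have := norm_sub_le_norm_sub_add_norm_sub x.2 y.2 z.2
  linarith

theorem isClosed_causalFuture {K : Set Minkowski} (hK : IsCompact K) :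
    IsClosed (causalFuture K) := by
  have hC : IsClosed {w : Minkowski | ‖w.2‖ ≤ w.1} :=
    isClosed_le (by fun_prop) (by fun_prop)
  convert hC.add_left_of_isCompact hK using 1
  ext x
  constructor
  · rintro ⟨y, hy, hxy⟩
    exact ⟨y, hy, x - y, hxy, by simp⟩
  · rintro ⟨y, hy, w, hw, rfl⟩
    exact ⟨y, hy, by simpa using hw⟩

/-- The form of global hyperbolicity used here: up to time `T`, past-compact supports are compact,
because a bounded time difference bounds the spatial distance from `K`. -/
theorem isCompact_causalFuture_inter {K : Set Minkowski} (hK : IsCompact K) (T : ℝ) :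
    IsCompact (causalFuture K ∩ {z | z.1 ≤ T}) := by
  refine Metric.isCompact_of_isClosed_isBounded
    ((isClosed_causalFuture hK).inter (isClosed_le continuous_fst continuous_const)) ?_
  obtain ⟨r, hr⟩ := hK.isBounded.subset_closedBall 0
  refine (Metric.isBounded_closedBall (x := (0 : Minkowski)) (r := 2 * |r| + |T|)).subset ?_
  rintro x ⟨⟨y, hy, hxy⟩, hx⟩
  have hy' : ‖y‖ ≤ r := by simpa using hr hy
  have h1 : |y.1| ≤ r := (norm_fst_le y).trans hy'
  have h2 : ‖y.2‖ ≤ r := (norm_snd_le y).trans hy'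
  have h3 : ‖x.2‖ ≤ ‖x.2 - y.2‖ + ‖y.2‖ := by simpa using norm_add_le (x.2 - y.2) y.2
  have h4 := norm_nonneg (x.2 - y.2)
  have h5 := abs_le.1 h1
  have h6 := le_abs_self r
  have h7 := le_abs_self T
  have h8 : x.1 ≤ T := hx
  have h9 := abs_nonneg T
  rw [mem_closedBall_zero_iff, Prod.norm_def]
  refine max_le (abs_le.2 ⟨?_, ?_⟩) ?_ <;> linarith

theorem tsupport_subset_causalFuture {K : Set Minkowski} (hK : IsCompact K) {u : Config}
    (hu : ∀ z ∉ causalFuture K, u z = 0) : tsupport u ⊆ causalFuture K :=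
  closure_minimal (fun z hz => by_contra fun h => hz (hu z h)) (isClosed_causalFuture hK)

theorem exists_cutoff {K : Set Minkowski} (hK : IsCompact K) :
    ∃ χ : Config, χ ∈ TestFun ∧ ∀ x ∈ K, ∀ᶠ y in 𝓝 x, χ y = 1 := by
  obtain ⟨K', hK', hKK'⟩ := exists_compact_superset hK
  obtain ⟨χ, h1, h0, -⟩ := exists_contMDiffMap_one_nhds_of_subset_interior (n := ⊤)
    𝓘(ℝ, Minkowski) hK.isClosed hKK'
  exact ⟨χ, HasCompactSupport.intro hK' h0, fun x hx => h1.filter_mono (nhds_le_nhdsSet hx)⟩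

end Causal

/-! ### The free retarded Green's operator -/

section FreeGreen

instance isLocallyFiniteMeasure_coneMeasure : IsLocallyFiniteMeasure coneMeasure :=
  ⟨fun x => by
    obtain ⟨s, hs, hint⟩ := locallyIntegrable_one_coneMeasure x
    refine ⟨s, hs, ?_⟩
    rcases (integrableOn_const_iff (by simp)).1 hint with h | h
    · simp at h
    · exact h⟩

theorem integrable_coneMeasure_comp_sub {f : Config} (hf : f ∈ TestFun) (z : Minkowski) :
    Integrable (fun w => f (z - w)) coneMeasure :=
  (f.reflect z).continuous.integrable_of_hasCompactSupport
    (HasCompactSupport.comp_homeomorph (f := f) hf (Homeomorph.subLeft z))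

theorem contDiff_integral_coneMeasure {f : Config} (hf : f ∈ TestFun) :
    ContDiff ℝ ∞ fun z => ∫ w, f (z - w) ∂coneMeasure := by
  have := HasCompactSupport.contDiff_convolution_right (n := ⊤) (ContinuousLinearMap.mul ℝ ℝ)
    hf locallyIntegrable_one_coneMeasure f.contDiff
  have e : (fun z => ∫ w, f (z - w) ∂coneMeasure) = convolution (fun _ => (1 : ℝ)) f
      (ContinuousLinearMap.mul ℝ ℝ) coneMeasure := by
    ext z
    simp [convolution_def]
  rw [e]
  exact this

theorem fderiv_integral_coneMeasure {f : Config} (hf : f ∈ TestFun) (z v : Minkowski) :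
    fderiv ℝ (fun z => ∫ w, f (z - w) ∂coneMeasure) z v =
      ∫ w, Config.partialDeriv v f (z - w) ∂coneMeasure := by
  -- The differentiation theorem allows a parameter; here it is a dummy in `ℝ`, and only the
  -- direction `(0, v)` is used.
  have h := hasFDerivAt_convolution_right_with_param (P := ℝ) (g := fun _ x => f x)
    (μ := coneMeasure) (k := tsupport f) (ContinuousLinearMap.mul ℝ ℝ) isOpen_univ hf
    (fun _ x _ hx => image_eq_zero_of_notMem_tsupport hx) locallyIntegrable_one_coneMeasure
    ((f.contDiff.comp contDiff_snd).contDiffOn.of_le (mod_cast le_top)) (0, z) trivial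
  have h2 := h.comp z (hasFDerivAt_prodMk_right (0 : ℝ) z)
  have hfd (x : Minkowski) : fderiv ℝ (fun p : ℝ × Minkowski => f p.2) (0, x) =
      (fderiv ℝ f x).comp (ContinuousLinearMap.snd ℝ ℝ Minkowski) :=
    ((f.differentiable x).hasFDerivAt.comp ((0 : ℝ), x) hasFDerivAt_snd).fderiv
  have hc : Continuous (fderiv ℝ f) := f.contDiff.continuous_fderiv (by simp)
  have e : (fun z => ∫ w, f (z - w) ∂coneMeasure) =
      (fun q : ℝ × Minkowski => convolution (fun _ => (1 : ℝ)) (fun x => f x)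
        (ContinuousLinearMap.mul ℝ ℝ) coneMeasure q.2) ∘ fun x => ((0 : ℝ), x) := by
    ext z
    simp [convolution_def]
  rw [e, h2.fderiv]
  simp only [ContinuousLinearMap.comp_apply, ContinuousLinearMap.inr_apply]
  change (convolution (fun _ => (1 : ℝ)) (fun x => fderiv ℝ (fun p : ℝ × Minkowski => f p.2) (0, x))
    ((ContinuousLinearMap.mul ℝ ℝ).precompR (ℝ × Minkowski)) coneMeasure z) (0, v) = _
  simp only [hfd]
  rw [convolution_precompR_apply _ locallyIntegrable_one_coneMeasure]
  · simp [convolution_def, Config.partialDeriv_apply]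
  · exact (HasCompactSupport.fderiv (𝕜 := ℝ) hf).comp_left
      (g := fun L : Minkowski →L[ℝ] ℝ => L.comp (ContinuousLinearMap.snd ℝ ℝ Minkowski)) (by simp)
  · exact hc.clm_comp continuous_const

/-- The retarded Green's operator of the wave operator. -/
noncomputable def freeGreen (f : TestFun) : Config :=
  ⟨fun z => ∫ w, (f : Config) (z - w) ∂coneMeasure, (contDiff_integral_coneMeasure f.2).contMDiff⟩

theorem freeGreen_apply (f : TestFun) (z : Minkowski) :
    freeGreen f z = ∫ w, (f : Config) (z - w) ∂coneMeasure := rfl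

theorem partialDeriv_freeGreen (v : Minkowski) (f : TestFun) :
    Config.partialDeriv v (freeGreen f) =
      freeGreen ⟨Config.partialDeriv v f, partialDeriv_mem_testFun v f.2⟩ := by
  ext z
  exact fderiv_integral_coneMeasure f.2 z v

/-- Convolution commutes with constant-coefficient operators, so the left inverse property is also
the right inverse property. -/
theorem kleinGordon_freeGreen (f : TestFun) : kleinGordon 0 (freeGreen f) = f := by
  ext z
  have hi (v : Minkowski) := integrable_coneMeasure_comp_sub
    (partialDeriv_mem_testFun v (partialDeriv_mem_testFun v f.2)) z
  rw [← integral_coneMeasure_kleinGordon f.2 z]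
  simp only [kleinGordon_apply, partialDeriv_freeGreen, freeGreen_apply]
  have h0 (x : Minkowski) : ((0 : Config) : Minkowski → ℝ) x = 0 := rfl
  simp only [h0, zero_mul, add_zero]
  rw [integral_sub (hi _) (integrable_finsetSum _ fun i _ => hi _),
    integral_finsetSum _ fun i _ => hi _]

theorem freeGreen_eq_zero (f : TestFun) {z : Minkowski}
    (hz : z ∉ causalFuture (tsupport (f : Config))) : freeGreen f z = 0 := by
  rw [freeGreen_apply]
  refine integral_eq_zero_of_ae ?_
  filter_upwards [ae_coneMeasure] with w hw
  refine image_eq_zero_of_notMem_tsupport fun h => hz ⟨z - w, h, ?_⟩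
  simpa using hw

/-- A configuration with past-compact support is the retarded potential of its source. -/
theorem eq_integral_kleinGordon_zero {K : Set Minkowski} (hK : IsCompact K) {u : Config}
    (hu : tsupport u ⊆ causalFuture K) (z : Minkowski) :
    u z = ∫ w, kleinGordon 0 u (z - w) ∂coneMeasure := by
  -- The integral only sees points in the causal past of `z`, all at times at most `z.1`. There `χ *
  -- u` and `u` agree locally, so the formula for test functions applies.
  obtain ⟨χ, hχ, h1⟩ := exists_cutoff (isCompact_causalFuture_inter hK z.1)
  have hloc (x : Minkowski) (hx : x.1 ≤ z.1) :
      ((χ * u : Config) : Minkowski → ℝ) =ᶠ[𝓝 x] u := by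
    by_cases hxK : x ∈ causalFuture K
    · filter_upwards [h1 x ⟨hxK, hx⟩] with y hy
      change χ y * u y = u y
      rw [hy, one_mul]
    · have : (u : Minkowski → ℝ) =ᶠ[𝓝 x] 0 :=
        notMem_tsupport_iff_eventuallyEq.1 fun h => hxK (hu h)
      filter_upwards [this] with y hy
      change χ y * u y = u y
      rw [hy]; simp
  rw [← (hloc z le_rfl).eq_of_nhds,
    ← integral_coneMeasure_kleinGordon (mul_mem_testFun hχ u) z]
  refine integral_congr_ae ?_
  filter_upwards [ae_coneMeasure] with w hw
  refine kleinGordon_eventuallyEq 0 (hloc _ ?_)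
  have := (norm_nonneg _).trans hw
  simpa using this

end FreeGreen

/-! ### Weighted estimates for all derivatives -/

section Estimates

/-- Iterated partial derivative along a family of constant vector fields. -/
noncomputable def Config.iterPartial : (k : ℕ) → (Fin k → Minkowski) → Config → Config
  | 0, _, φ => φ
  | k + 1, v, φ => Config.partialDeriv (v 0) (Config.iterPartial k (Fin.tail v) φ)

theorem Config.iterPartial_apply (k : ℕ) (v : Fin k → Minkowski) (φ : Config) (z : Minkowski) :
    Config.iterPartial k v φ z = iteratedFDeriv ℝ k φ z v := by
  induction k generalizing z with
  | zero => simp [Config.iterPartial]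
  | succ k ih =>
    rw [iteratedFDeriv_succ_apply_left]
    have e : (Config.iterPartial k (Fin.tail v) φ : Minkowski → ℝ) =
        fun z => iteratedFDeriv ℝ k φ z (Fin.tail v) := funext fun z => ih _ z
    change fderiv ℝ (Config.iterPartial k (Fin.tail v) φ) z (v 0) = _
    rw [e]
    have hd : DifferentiableAt ℝ (iteratedFDeriv ℝ k φ) z :=
      φ.contDiff.differentiable_iteratedFDeriv (mod_cast WithTop.coe_lt_top k) z
    have h := ((ContinuousMultilinearMap.apply ℝ (fun _ : Fin k => Minkowski) ℝ
      (Fin.tail v)).hasFDerivAt.comp z hd.hasFDerivAt).fderiv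
    exact congrArg (fun L : Minkowski →L[ℝ] ℝ => L (v 0)) h

theorem Config.iterPartial_kleinGordon_zero (k : ℕ) (v : Fin k → Minkowski) (φ : Config) :
    kleinGordon 0 (Config.iterPartial k v φ) = Config.iterPartial k v (kleinGordon 0 φ) := by
  induction k with
  | zero => rfl
  | succ k ih => rw [Config.iterPartial, Config.iterPartial, ← ih,
      Config.partialDeriv_kleinGordon_zero]

theorem Config.tsupport_iterPartial_subset (k : ℕ) (v : Fin k → Minkowski) (φ : Config) :
    tsupport (Config.iterPartial k v φ) ⊆ tsupport φ := by
  induction k with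
  | zero => rfl
  | succ k ih => exact (tsupport_partialDeriv_subset _ _).trans (ih _)

/-- All derivatives of order at most `k` are bounded by `A e^{at}` at times `t ≤ T`. -/
def HasExpBound (a T : ℝ) (k : ℕ) (A : ℝ) (u : Config) : Prop :=
  ∀ j ≤ k, ∀ z : Minkowski, z.1 ≤ T → ‖iteratedFDeriv ℝ j u z‖ ≤ A * Real.exp (a * z.1)

/-- Each derivative of `u` is the retarded potential of the same derivative of the source. As
`e^{a(t - s)} = e^{at} e^{-as}`, the convolution multiplies the weighted bound by the Laplace
transform of the measure. Only source times `≤ T` enter. -/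
theorem HasExpBound.of_kleinGordon_zero {K : Set Minkowski} (hK : IsCompact K) {u : Config}
    (hu : tsupport u ⊆ causalFuture K) {a T A : ℝ} (ha : 0 < a) (hA : 0 ≤ A) {k : ℕ}
    (h : HasExpBound a T k A (kleinGordon 0 u)) :
    HasExpBound a T k ((∫ w : Minkowski, Real.exp (-(a * w.1)) ∂coneMeasure) * A) u := by
  intro j hj z hz
  have hI : 0 ≤ ∫ w : Minkowski, Real.exp (-(a * w.1)) ∂coneMeasure :=
    integral_nonneg fun w => (Real.exp_pos _).le
  refine ContinuousMultilinearMap.opNorm_le_bound (by positivity) fun v => ?_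
  rw [← Config.iterPartial_apply, eq_integral_kleinGordon_zero hK
    ((Config.tsupport_iterPartial_subset j v u).trans hu) z, Config.iterPartial_kleinGordon_zero]
  have hint := ((integrable_exp_coneMeasure ha).const_mul
    (A * Real.exp (a * z.1) * ∏ i, ‖v i‖))
  refine (norm_integral_le_of_norm_le hint ?_).trans (le_of_eq ?_)
  · filter_upwards [ae_coneMeasure] with w hw
    have hw0 : 0 ≤ w.1 := (norm_nonneg _).trans hw
    rw [Config.iterPartial_apply]
    refine (ContinuousMultilinearMap.le_opNorm _ v).trans ?_
    have h1 := h j hj (z - w) (by simp; linarith)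
    refine (mul_le_mul_of_nonneg_right h1 (by positivity)).trans (le_of_eq ?_)
    rw [Prod.fst_sub, mul_sub, sub_eq_add_neg, Real.exp_add]
    ring
  · rw [integral_const_mul]
    ring

theorem norm_iteratedFDeriv_mul_le_of_le {m u : Config} {z : Minkowski} {k : ℕ} {B A : ℝ}
    (hB : 0 ≤ B) (hm : ∀ j ≤ k, ‖iteratedFDeriv ℝ j m z‖ ≤ B)
    (hu : ∀ j ≤ k, ‖iteratedFDeriv ℝ j u z‖ ≤ A) {j : ℕ} (hj : j ≤ k) :
    ‖iteratedFDeriv ℝ j (m * u : Config) z‖ ≤ 2 ^ k * B * A := by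
  have hA : 0 ≤ A := (norm_nonneg _).trans (hu 0 (Nat.zero_le _))
  have h := norm_iteratedFDeriv_mul_le (𝕜 := ℝ) m.contDiff u.contDiff z (n := j)
    (mod_cast le_top)
  refine h.trans ?_
  calc _ ≤ ∑ i ∈ Finset.range (j + 1), (j.choose i : ℝ) * (B * A) := by
        refine Finset.sum_le_sum fun i hi => ?_
        have hij : i ≤ j := Nat.lt_succ_iff.1 (Finset.mem_range.1 hi)
        rw [mul_assoc]
        exact mul_le_mul_of_nonneg_left (mul_le_mul (hm i (hij.trans hj))
          (hu _ ((Nat.sub_le _ _).trans hj)) (norm_nonneg _) hB) (by positivity)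
    _ = 2 ^ j * (B * A) := by
        rw [← Finset.sum_mul]
        congr 1
        exact_mod_cast Nat.sum_range_choose j
    _ ≤ 2 ^ k * (B * A) :=
        mul_le_mul_of_nonneg_right (pow_le_pow_right₀ one_le_two hj) (by positivity)
    _ = _ := by ring

theorem exists_bound_iteratedFDeriv (m : Config) {S : Set Minkowski} (hS : IsCompact S) (k : ℕ) :
    ∃ B, 0 ≤ B ∧ ∀ j ≤ k, ∀ z ∈ S, ‖iteratedFDeriv ℝ j m z‖ ≤ B := by
  have h (j : ℕ) : ∃ B, ∀ z ∈ S, ‖iteratedFDeriv ℝ j m z‖ ≤ B :=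
    hS.exists_bound_of_continuousOn
      (m.contDiff.continuous_iteratedFDeriv (mod_cast le_top)).continuousOn
  choose B hB using h
  refine ⟨∑ j ∈ Finset.range (k + 1), |B j|, by positivity, fun j hj z hz => ?_⟩
  refine ((hB j z hz).trans (le_abs_self _)).trans ?_
  exact Finset.single_le_sum (f := fun j => |B j|) (fun i _ => abs_nonneg _)
    (Finset.mem_range.2 (Nat.lt_succ_of_le hj))

theorem iteratedFDeriv_eq_zero_of_notMem_tsupport {u : Config} {z : Minkowski}
    (hz : z ∉ tsupport u) (j : ℕ) : iteratedFDeriv ℝ j u z = 0 :=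
  image_eq_zero_of_notMem_tsupport fun h => hz (tsupport_iteratedFDeriv_subset j h)

theorem tsupport_mul_subset_config_right (m u : Config) :
    tsupport (m * u : Config) ⊆ tsupport u :=
  tsupport_mul_subset_right (f := m) (g := u)

/-- Compactness alone gives some finite bound, with no control of its size; it is what the
iterations start from. -/
theorem exists_hasExpBound {K : Set Minkowski} (hK : IsCompact K) {u : Config}
    (hu : tsupport u ⊆ causalFuture K) (a T : ℝ) (k : ℕ) :
    ∃ A, 0 ≤ A ∧ HasExpBound a T k A u := by
  have hS := isCompact_causalFuture_inter hK T
  obtain ⟨B, hB0, hB⟩ := exists_bound_iteratedFDeriv u hS k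
  obtain ⟨E, hE⟩ := hS.exists_bound_of_continuousOn (f := fun z => Real.exp (-(a * z.1)))
    (by fun_prop)
  refine ⟨B * |E|, by positivity, fun j hj z hz => ?_⟩
  by_cases hzK : z ∈ causalFuture K
  · refine (hB j hj z ⟨hzK, hz⟩).trans ?_
    rw [mul_assoc]
    refine le_mul_of_one_le_right hB0 ?_
    have h1 := (hE z ⟨hzK, hz⟩).trans (le_abs_self E)
    rw [Real.norm_of_nonneg (Real.exp_pos _).le] at h1
    refine le_trans (le_of_eq ?_) (mul_le_mul_of_nonneg_right h1 (Real.exp_pos (a * z.1)).le)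
    rw [← Real.exp_add]; simp
  · rw [iteratedFDeriv_eq_zero_of_notMem_tsupport fun h => hzK (hu h)]
    simp only [norm_zero]
    positivity

/-- The order of quantifiers matters: `C` does not depend on `a`, so `a` can be chosen afterwards to
beat it. -/
theorem exists_mul_hasExpBound (m : Config) {K : Set Minkowski} (hK : IsCompact K)
    (T : ℝ) (k : ℕ) :
    ∃ C, 0 ≤ C ∧ ∀ u : Config, tsupport u ⊆ causalFuture K → ∀ a A : ℝ, 0 ≤ A →
      HasExpBound a T k A u → HasExpBound a T k (C * A) (m * u) := by
  obtain ⟨B, hB0, hB⟩ := exists_bound_iteratedFDeriv m (isCompact_causalFuture_inter hK T) k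
  refine ⟨2 ^ k * B, by positivity, fun u hu a A hA h j hj z hz => ?_⟩
  by_cases hzK : z ∈ causalFuture K
  · rw [mul_assoc]
    exact norm_iteratedFDeriv_mul_le_of_le hB0 (fun i hi => hB i hi z ⟨hzK, hz⟩)
      (fun i hi => h i hi z hz) hj
  · rw [iteratedFDeriv_eq_zero_of_notMem_tsupport fun h =>
      hzK (hu (tsupport_mul_subset_config_right m u h))]
    simp only [norm_zero]
    positivity

theorem HasExpBound.sub {a T A A' : ℝ} {k : ℕ} {u u' : Config} (h : HasExpBound a T k A u)
    (h' : HasExpBound a T k A' u') : HasExpBound a T k (A + A') (u - u') := by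
  intro j hj z hz
  have e : iteratedFDeriv ℝ j (u - u' : Config) z =
      iteratedFDeriv ℝ j u z - iteratedFDeriv ℝ j u' z :=
    iteratedFDeriv_sub_apply (u.contDiff.of_le (mod_cast le_top)).contDiffAt
      (u'.contDiff.of_le (mod_cast le_top)).contDiffAt
  rw [e, add_mul]
  exact (norm_sub_le _ _).trans (add_le_add (h j hj z hz) (h' j hj z hz))

theorem HasExpBound.mono {a T A A' : ℝ} {k : ℕ} {u : Config} (h : HasExpBound a T k A u)
    (hA : A ≤ A') : HasExpBound a T k A' u := fun j hj z hz =>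
  (h j hj z hz).trans (mul_le_mul_of_nonneg_right hA (Real.exp_pos _).le)

/-- The weighted a priori estimate for the Klein-Gordon operator with variable mass. -/
theorem exists_hasExpBound_of_kleinGordon (m : Config) {K : Set Minkowski} (hK : IsCompact K)
    (T : ℝ) (k : ℕ) {ε : ℝ} (hε : 0 < ε) :
    ∃ a : ℝ, ∀ u : Config, tsupport u ⊆ causalFuture K → ∀ A : ℝ, 0 ≤ A →
      HasExpBound a T k A (kleinGordon m u) → HasExpBound a T k (ε * A) u := by
  obtain ⟨C, hC0, hC⟩ := exists_mul_hasExpBound m hK T k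
  -- The two bounds on `κ` serve the source term (`κ ≤ ε / 2`) and the mass term (`κ * C ≤ 1 / 2`);
  -- `C + 1` avoids division by zero.
  obtain ⟨a, ha, hI⟩ := exists_integral_exp_coneMeasure_le
    (ε := min (ε / 2) (1 / (2 * (C + 1)))) (by positivity)
  refine ⟨a, fun u hu A hA h => ?_⟩
  set κ := ∫ w : Minkowski, Real.exp (-(a * w.1)) ∂coneMeasure with hκ
  have hκ0 : 0 ≤ κ := integral_nonneg fun w => (Real.exp_pos _).le
  have hκ1 : κ ≤ ε / 2 := hI.trans (min_le_left _ _)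
  have hκ2 : κ * C ≤ 1 / 2 := by
    have h1 : κ ≤ 1 / (2 * (C + 1)) := hI.trans (min_le_right _ _)
    rw [le_div_iff₀ (by positivity)] at h1
    nlinarith
  obtain ⟨A₀, hA₀, h₀⟩ := exists_hasExpBound hK hu a T k
  have step (A' : ℝ) (hA' : 0 ≤ A') (h' : HasExpBound a T k A' u) :
      HasExpBound a T k (κ * (A + C * A')) u := by
    refine HasExpBound.of_kleinGordon_zero hK hu ha (by positivity) ?_
    have e : kleinGordon 0 u = kleinGordon m u - m * u := by
      rw [kleinGordon_eq_zero_add m u, add_sub_cancel_right]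
    rw [e]
    exact h.sub (hC u hu a A' hA' h')
  -- Moving `m * u` to the source side and applying the free estimate halves the uncontrolled
  -- constant `A₀`, while `ε * A` reproduces itself.
  have iter (n : ℕ) : HasExpBound a T k (ε * A + A₀ * (1 / 2) ^ n) u := by
    induction n with
    | zero => exact h₀.mono (by simp; positivity)
    | succ n ih =>
      refine (step _ (by positivity) ih).mono ?_
      have hp : 0 ≤ A₀ * (1 / 2) ^ n := by positivity
      rw [pow_succ]
      nlinarith [mul_le_mul_of_nonneg_right hκ1 hA, mul_le_mul_of_nonneg_right hκ2 hp,
        mul_le_mul_of_nonneg_right hκ2 (mul_nonneg hε.le hA)]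
  intro j hj z hz
  have hlim : Tendsto (fun n : ℕ => (ε * A + A₀ * (1 / 2) ^ n) * Real.exp (a * z.1)) atTop
      (𝓝 ((ε * A + A₀ * 0) * Real.exp (a * z.1))) :=
    (((tendsto_pow_atTop_nhds_zero_of_lt_one (by norm_num) (by norm_num)).const_mul
      A₀).const_add _).mul_const _
  rw [mul_zero, add_zero] at hlim
  exact ge_of_tendsto' hlim fun n => iter n j hj z hz

/-- Uniqueness for the Klein-Gordon equation among past-compact configurations. -/
theorem eq_zero_of_kleinGordon_eq_zero (m : Config) {K : Set Minkowski} (hK : IsCompact K)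
    {u : Config} (hu : tsupport u ⊆ causalFuture K) {T : ℝ}
    (h : ∀ z : Minkowski, z.1 < T → kleinGordon m u z = 0) {z : Minkowski} (hz : z.1 < T) :
    u z = 0 := by
  -- Up to time `z.1 < T` the source vanishes, so the estimate applies with `A = 0`.
  obtain ⟨a, ha⟩ := exists_hasExpBound_of_kleinGordon m hK z.1 0 one_pos
  have := ha u hu 0 le_rfl (fun j hj x hx => by
    obtain rfl : j = 0 := Nat.le_zero.1 hj
    simp [h x (hx.trans_lt hz)]) 0 le_rfl z le_rfl
  simpa using this

end Estimates

/-! ### Existence for the Klein-Gordon equation -/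

section Existence

/-- One step of the Volterra iteration `g ↦ -m Δ g`. -/
noncomputable def volterraStep (m g : TestFun) : TestFun :=
  ⟨((-m : TestFun) : Config) * freeGreen g, mul_mem_testFun (-m).2 _⟩

theorem volterraStep_apply (m g : TestFun) (z : Minkowski) :
    (volterraStep m g : Config) z = -((m : Config) z) * freeGreen g z := rfl

/-- Every step multiplies by `m`, so all iterates live in one compact set. There weighted bounds are
uniform bounds, and the series has compact support. -/
theorem tsupport_volterraStep_iterate_subset (m f : TestFun) (n : ℕ) :
    tsupport (((volterraStep m)^[n] f : TestFun) : Config) ⊆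
      tsupport (f : Config) ∪ tsupport (m : Config) := by
  cases n with
  | zero => exact Set.subset_union_left
  | succ n =>
    rw [Function.iterate_succ_apply']
    refine Set.Subset.trans (closure_mono fun z hz => ?_) Set.subset_union_right
    intro h
    exact hz (by rw [volterraStep_apply, h]; simp)

theorem volterraStep_iterate_causal (m f : TestFun) (n : ℕ) :
    tsupport (((volterraStep m)^[n] f : TestFun) : Config) ⊆
      causalFuture (tsupport (f : Config)) := by
  induction n with
  | zero => exact subset_causalFuture _
  | succ n ih =>
    refine tsupport_subset_causalFuture f.2 fun z hz => ?_
    rw [Function.iterate_succ_apply', volterraStep_apply, freeGreen_eq_zero, mul_zero]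
    exact fun h => hz (causalFuture_causalFuture_subset _ (causalFuture_mono ih h))

theorem tsupport_freeGreen_subset {K : Set Minkowski} (hK : IsCompact K) {g : TestFun}
    (hg : tsupport (g : Config) ⊆ causalFuture K) : tsupport (freeGreen g) ⊆ causalFuture K :=
  tsupport_subset_causalFuture hK fun _ hz => freeGreen_eq_zero g fun h =>
    hz (causalFuture_causalFuture_subset _ (causalFuture_mono hg h))

theorem exists_bound_volterraStep_iterate (m f : TestFun) (k : ℕ) :
    ∃ D : ℝ, ∀ n z, ‖iteratedFDeriv ℝ k (((volterraStep m)^[n] f : TestFun) : Config) z‖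
      ≤ D * (1 / 2) ^ n := by
  have hS : IsCompact (tsupport (f : Config) ∪ tsupport (m : Config)) := IsCompact.union f.2 m.2
  obtain ⟨r, hr⟩ := hS.isBounded.subset_closedBall 0
  obtain ⟨C, hC0, hC⟩ := exists_mul_hasExpBound ((-m : TestFun) : Config) f.2 r k
  obtain ⟨a, ha, hI⟩ := exists_integral_exp_coneMeasure_le
    (ε := 1 / (2 * (C + 1))) (by positivity)
  obtain ⟨A, hA, h0⟩ := exists_hasExpBound f.2 (subset_causalFuture _) a r k
  set κ := ∫ w : Minkowski, Real.exp (-(a * w.1)) ∂coneMeasure with hκ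
  have hκ0 : 0 ≤ κ := integral_nonneg fun w => (Real.exp_pos _).le
  have hκ2 : C * κ ≤ 1 / 2 := by
    rw [le_div_iff₀ (by positivity)] at hI
    nlinarith
  have hb (n : ℕ) : HasExpBound a r k (A * (1 / 2) ^ n)
      (((volterraStep m)^[n] f : TestFun) : Config) := by
    induction n with
    | zero => simpa using h0
    | succ n ih =>
      rw [Function.iterate_succ_apply']
      have hs := tsupport_freeGreen_subset f.2 (volterraStep_iterate_causal m f n)
      have h1 : HasExpBound a r k (κ * (A * (1 / 2) ^ n))
          (freeGreen ((volterraStep m)^[n] f)) :=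
        HasExpBound.of_kleinGordon_zero f.2 hs ha (by positivity)
          (by rw [kleinGordon_freeGreen]; exact ih)
      refine HasExpBound.mono (hC _ hs a _ (by positivity) h1) ?_
      have hp : 0 ≤ A * (1 / 2) ^ n := by positivity
      rw [pow_succ]
      nlinarith [mul_le_mul_of_nonneg_right hκ2 hp]
  -- `e^{ar}` bounds the weight on the common support, where `t ≤ r`.
  refine ⟨A * Real.exp (a * r), fun n z => ?_⟩
  by_cases hz : z ∈ tsupport (f : Config) ∪ tsupport (m : Config)
  · have hzr : z.1 ≤ r := (le_abs_self _).trans ((norm_fst_le z).trans (by simpa using hr hz))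
    refine (hb n k le_rfl z hzr).trans ?_
    rw [mul_right_comm]
    gcongr
  · rw [iteratedFDeriv_eq_zero_of_notMem_tsupport fun h =>
      hz (tsupport_volterraStep_iterate_subset m f n h)]
    simp only [norm_zero]
    positivity

/-- Sum and integral may be exchanged because the cone measure of a compact set is finite and the
terms decay geometrically. -/
theorem hasSum_freeGreen {g : ℕ → TestFun} {s : TestFun} {S : Set Minkowski} (hS : IsCompact S)
    (hgS : ∀ n, ∀ z ∉ S, (g n : Config) z = 0) {D : ℝ}
    (hD : ∀ n z, ‖(g n : Config) z‖ ≤ D * (1 / 2) ^ n)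
    (hs : ∀ z, (s : Config) z = ∑' n, (g n : Config) z) (z : Minkowski) :
    HasSum (fun n => freeGreen (g n) z) (freeGreen s z) := by
  have hS' : IsCompact ((fun w => z - w) ⁻¹' S) :=
    (Homeomorph.subLeft z).isCompact_preimage.2 hS
  have h := hasSum_integral_of_summable_integral_norm (μ := coneMeasure)
    (F := fun n w => (g n : Config) (z - w))
    (fun n => integrable_coneMeasure_comp_sub (g n).2 z) ?_
  · simp only [freeGreen_apply, hs]
    exact h
  · refine Summable.of_nonneg_of_le (fun n => integral_nonneg fun w => norm_nonneg _)
      (fun n => ?_) ((summable_geometric_of_lt_one (by norm_num) (by norm_num :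
        (1 / 2 : ℝ) < 1)).mul_left (D * coneMeasure.real ((fun w => z - w) ⁻¹' S)))
    rw [← setIntegral_eq_integral_of_forall_compl_eq_zero (s := (fun w => z - w) ⁻¹' S)
      fun w hw => by rw [hgS n _ hw, norm_zero]]
    have h1 := norm_setIntegral_le_of_norm_le_const (μ := coneMeasure)
      (f := fun w => ‖(g n : Config) (z - w)‖) (s := (fun w => z - w) ⁻¹' S)
      (C := D * (1 / 2) ^ n) hS'.measure_lt_top
      (fun w _ => by rw [norm_norm]; exact hD n _)
    refine (le_abs_self _).trans (h1.trans (le_of_eq ?_))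
    ring

/-- With the ansatz `u = Δ s`, `Δ` the free retarded operator, the equation becomes `s + m Δ s = f`,
solved by `s = ∑ (-m Δ)^n f`. -/
theorem exists_solution_of_testFun_mass (m f : TestFun) :
    ∃ u : Config, kleinGordon m u = f ∧
      tsupport u ⊆ causalFuture (tsupport (f : Config)) := by
  set g : ℕ → TestFun := fun n => (volterraStep m)^[n] f with hg
  have hS : IsCompact (tsupport (f : Config) ∪ tsupport (m : Config)) := IsCompact.union f.2 m.2
  choose D hD using exists_bound_volterraStep_iterate m f
  have hgeo : Summable fun n : ℕ => (1 / 2 : ℝ) ^ n :=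
    summable_geometric_of_lt_one (by norm_num) (by norm_num)
  have hsmooth : ContDiff ℝ ∞ fun z => ∑' n, (g n : Config) z :=
    contDiff_tsum (N := ⊤) (v := fun k n => D k * (1 / 2) ^ n) (fun n => (g n : Config).contDiff)
      (fun k _ => hgeo.mul_left _) (fun k n z _ => hD k n z)
  have hgS (n : ℕ) (z) (hz : z ∉ tsupport (f : Config) ∪ tsupport (m : Config)) :
      (g n : Config) z = 0 :=
    image_eq_zero_of_notMem_tsupport fun h => hz (tsupport_volterraStep_iterate_subset m f n h)
  have hD0 (n : ℕ) (z : Minkowski) : ‖(g n : Config) z‖ ≤ D 0 * (1 / 2) ^ n := by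
    have := hD 0 n z
    rwa [norm_iteratedFDeriv_zero] at this
  let s : TestFun := ⟨⟨fun z => ∑' n, (g n : Config) z, hsmooth.contMDiff⟩,
    HasCompactSupport.intro hS fun z hz => by simp [hgS _ z hz]⟩
  have hs (z : Minkowski) : (s : Config) z = ∑' n, (g n : Config) z := rfl
  have hsum (z : Minkowski) : Summable fun n => (g n : Config) z :=
    Summable.of_norm_bounded (hgeo.mul_left (D 0)) fun n => hD0 n z
  have hsupp : tsupport (s : Config) ⊆ causalFuture (tsupport (f : Config)) := by
    refine tsupport_subset_causalFuture f.2 fun z hz => ?_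
    have (n : ℕ) : (g n : Config) z = 0 :=
      image_eq_zero_of_notMem_tsupport fun h => hz (volterraStep_iterate_causal m f n h)
    rw [hs]
    simp [this]
  refine ⟨freeGreen s, ?_, tsupport_freeGreen_subset f.2 hsupp⟩
  rw [kleinGordon_eq_zero_add, kleinGordon_freeGreen]
  ext z
  change (s : Config) z + (m : Config) z * freeGreen s z = (f : Config) z
  have hstep (n : ℕ) : (g (n + 1) : Config) z = -((m : Config) z) * freeGreen (g n) z := by
    simp only [hg]
    rw [Function.iterate_succ_apply', volterraStep_apply]
  rw [hs, (hsum z).tsum_eq_zero_add, ← (hasSum_freeGreen hS hgS hD0 hs z).tsum_eq]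
  simp only [hstep]
  rw [tsum_mul_left]
  simp only [hg, Function.iterate_zero, id_eq]
  ring

theorem eq_of_kleinGordon_eq (m : Config) {K : Set Minkowski} (hK : IsCompact K) {u u' : Config}
    (hu : tsupport u ⊆ causalFuture K) (hu' : tsupport u' ⊆ causalFuture K) {T : ℝ}
    (h : ∀ z : Minkowski, z.1 < T → kleinGordon m u z = kleinGordon m u' z) {z : Minkowski}
    (hz : z.1 < T) : u z = u' z := by
  have hs : tsupport (u - u' : Config) ⊆ causalFuture K :=
    (tsupport_sub (u : Minkowski → ℝ) u').trans (Set.union_subset hu hu')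
  refine sub_eq_zero.1 (eq_zero_of_kleinGordon_eq_zero m hK hs (T := T) (fun x hx => ?_) hz)
  rw [map_sub]
  exact sub_eq_zero.2 (h x hx)

theorem kleinGordon_injOn (m : Config) {K : Set Minkowski} (hK : IsCompact K) {u u' : Config}
    (hu : tsupport u ⊆ causalFuture K) (hu' : tsupport u' ⊆ causalFuture K)
    (h : kleinGordon m u = kleinGordon m u') : u = u' := by
  ext z
  exact eq_of_kleinGordon_eq m hK hu hu' (T := z.1 + 1) (fun x _ => by rw [h]) (by simp)

/-- Up to time `N` the solution only feels `m` on a compact set, so `m` may be cut off there.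
Uniqueness up to a given time makes the resulting solutions agree on overlaps. -/
theorem exists_solution (m : Config) (f : TestFun) :
    ∃ u : Config, kleinGordon m u = f ∧
      tsupport u ⊆ causalFuture (tsupport (f : Config)) := by
  have hloc (N : ℕ) : ∃ u : Config, tsupport u ⊆ causalFuture (tsupport (f : Config)) ∧
      ∀ z : Minkowski, z.1 < N → kleinGordon m u z = (f : Config) z := by
    obtain ⟨χ, hχ, h1⟩ := exists_cutoff (isCompact_causalFuture_inter f.2 N)
    obtain ⟨u, hu, hsu⟩ := exists_solution_of_testFun_mass ⟨χ * m, mul_mem_testFun hχ m⟩ f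
    refine ⟨u, hsu, fun z hz => ?_⟩
    rw [← hu, kleinGordon_apply, kleinGordon_apply]
    congr 1
    change m z * u z = (χ z * m z) * u z
    by_cases hzK : z ∈ causalFuture (tsupport (f : Config))
    · rw [(h1 z ⟨hzK, hz.le⟩).self_of_nhds, one_mul]
    · rw [image_eq_zero_of_notMem_tsupport fun h => hzK (hsu h), mul_zero, mul_zero]
  choose u hsu hu using hloc
  have hcons {N N' : ℕ} {z : Minkowski} (h : z.1 < N) (h' : z.1 < N') : u N z = u N' z :=
    eq_of_kleinGordon_eq m f.2 (hsu N) (hsu N') (T := min N N')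
      (fun x hx => by rw [hu N x (lt_min_iff.1 hx).1, hu N' x (lt_min_iff.1 hx).2])
      (lt_min h h')
  -- The index `⌊t⌋₊ + 1` exceeds `t` strictly, for negative `t` too, so the choice is valid on a
  -- neighbourhood.
  have hfl (z : Minkowski) : z.1 < ((⌊z.1⌋₊ + 1 : ℕ) : ℝ) := by
    push_cast; exact Nat.lt_floor_add_one _
  have hev (z : Minkowski) : (fun y : Minkowski => u (⌊y.1⌋₊ + 1) y) =ᶠ[𝓝 z]
      u (⌊z.1⌋₊ + 1) := by
    filter_upwards [(isOpen_lt continuous_fst continuous_const).mem_nhds (hfl z)] with y hy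
    exact hcons (hfl y) hy
  let U : Config := ⟨fun y => u (⌊y.1⌋₊ + 1) y, (contDiff_iff_contDiffAt.2 fun z =>
    (u _).contDiff.contDiffAt.congr_of_eventuallyEq (hev z)).contMDiff⟩
  refine ⟨U, ?_, ?_⟩
  · ext z
    rw [← hu _ z (hfl z)]
    exact kleinGordon_eventuallyEq m (hev z)
  · refine tsupport_subset_causalFuture f.2 fun z hz => ?_
    have h0 : u (⌊z.1⌋₊ + 1) z = 0 := image_eq_zero_of_notMem_tsupport fun h => hz (hsu _ h)
    exact h0

/-- Linearity and the left inverse property both follow from uniqueness, once the two sides are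
placed in the future of a common compact set. -/
theorem exists_isRetardedGreen (m : Config) : ∃ G : TestFun →ₗ[ℝ] Config, IsRetardedGreen m G := by
  choose G hG hsG using exists_solution m
  refine ⟨⟨⟨G, fun f g => ?_⟩, fun c f => ?_⟩, hG, fun f => ?_, hsG⟩
  · refine kleinGordon_injOn m (IsCompact.union (f + g).2 (IsCompact.union f.2 g.2))
      ((hsG _).trans (causalFuture_mono Set.subset_union_left)) ?_ ?_
    · refine (tsupport_add (G f : Minkowski → ℝ) (G g)).trans (Set.union_subset ?_ ?_)
      · exact (hsG f).trans (causalFuture_mono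
          (Set.subset_union_left.trans Set.subset_union_right))
      · exact (hsG g).trans (causalFuture_mono
          (Set.subset_union_right.trans Set.subset_union_right))
    · rw [hG, map_add, hG, hG]; rfl
  · refine kleinGordon_injOn m (IsCompact.union (c • f).2 f.2)
      ((hsG _).trans (causalFuture_mono Set.subset_union_left)) ?_ ?_
    · refine Set.Subset.trans ?_ ((hsG f).trans (causalFuture_mono Set.subset_union_right))
      exact tsupport_smul_subset_right (fun _ => c) (G f)
    · rw [hG, map_smul, hG]; rfl
  · refine kleinGordon_injOn m (IsCompact.union (kleinGordon_mem_testFun m f.2) f.2)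
      ((hsG _).trans (causalFuture_mono Set.subset_union_left))
      (Set.subset_union_right.trans (subset_causalFuture _)) (hG _)

theorem IsRetardedGreen.unique {m : Config} {G G' : TestFun →ₗ[ℝ] Config}
    (h : IsRetardedGreen m G) (h' : IsRetardedGreen m G') : G = G' :=
  LinearMap.ext fun f => kleinGordon_injOn m f.2 (h.supp_subset f) (h'.supp_subset f)
    (by rw [h.right_inverse, h'.right_inverse])

end Existence

/-! ### The Møller map and its Neumann series -/

section Moller

theorem massFunctional_zero (M : TestFun) : massFunctional M 0 = 0 := by
  have (x : Minkowski) : ((0 : Config) : Minkowski → ℝ) x = 0 := rfl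
  simp [massFunctional, this]

/-- A variation supported where `M` vanishes is not seen by the functional. Conversely, a bump near
a point `y` with `M y ≠ 0`, supported where `M` keeps its sign, changes the value at the zero
configuration. -/
theorem functionalSupport_massFunctional (M : TestFun) :
    functionalSupport (massFunctional M) = tsupport (M : Config) := by
  refine Set.Subset.antisymm (fun x hx => ?_) fun x hx U hU => ?_
  · by_contra hxM
    obtain ⟨φ, ψ, hψ, hne⟩ := hx _ ((isClosed_tsupport _).isOpen_compl.mem_nhds hxM)
    refine hne ?_
    unfold massFunctional
    congr 2
    ext z
    by_cases hz : z ∈ tsupport (M : Config)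
    · have : ψ z = 0 := image_eq_zero_of_notMem_tsupport fun h => hψ h hz
      change (M : Config) z * (φ z + ψ z) ^ 2 = _
      rw [this, add_zero]
    · rw [image_eq_zero_of_notMem_tsupport hz, zero_mul, zero_mul]
  · obtain ⟨V, hVU, hV, hxV⟩ := mem_nhds_iff.1 hU
    obtain ⟨y, hyV, hy⟩ := mem_closure_iff.1 hx V hV hxV
    -- Multiplying by `M y` treats both signs of `M y` at once.
    have hW : V ∩ {z | 0 < (M : Config) y * (M : Config) z} ∈ 𝓝 y := by
      refine (hV.inter (isOpen_lt continuous_const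
        (continuous_const.mul (M : Config).continuous))).mem_nhds ⟨hyV, ?_⟩
      exact mul_self_pos.2 hy
    obtain ⟨b, hbW, hbc, hb, -, hby⟩ := exists_contDiff_tsupport_subset (n := ⊤) hW
    let ψ : Config := ⟨b, hb.contMDiff⟩
    refine ⟨0, ψ, hbW.trans (Set.inter_subset_left.trans hVU), ?_⟩
    rw [zero_add, massFunctional_zero]
    have hpos : 0 < ∫ z, (M : Config) y * ((M : Config) z * ψ z ^ 2) := by
      have hc : Continuous fun z => (M : Config) y * ((M : Config) z * ψ z ^ 2) :=
        continuous_const.mul ((M : Config).continuous.mul (ψ.continuous.pow 2))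
      refine hc.integral_pos_of_hasCompactSupport_nonneg_nonzero (x := y) ?_ ?_ ?_
      · refine HasCompactSupport.intro hbc fun z hz => ?_
        have : ψ z = 0 := image_eq_zero_of_notMem_tsupport hz
        simp [this]
      · intro z
        by_cases hz : z ∈ tsupport b
        · have h1 : 0 < (M : Config) y * (M : Config) z := (hbW hz).2
          simp only [Pi.zero_apply]
          rw [← mul_assoc]
          positivity
        · have : ψ z = 0 := image_eq_zero_of_notMem_tsupport hz
          simp [this]
      · have : ψ y = 1 := hby
        rw [this]
        simpa using hy
    rw [integral_const_mul] at hpos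
    unfold massFunctional
    intro h0
    have : ∫ z, (M : Config) z * ψ z ^ 2 = 0 := by linarith
    rw [this, mul_zero] at hpos
    exact lt_irrefl _ hpos

theorem kleinGordon_add_mass (m M φ : Config) :
    kleinGordon (m + M) φ = kleinGordon m φ + M * φ := by
  rw [kleinGordon_eq_zero_add, kleinGordon_eq_zero_add m, add_mul, add_assoc]

theorem tsupport_massDeriv_subset (M : TestFun) (φ : Config) :
    tsupport (massDeriv M φ : Config) ⊆ tsupport (M : Config) :=
  tsupport_mul_subset_left (f := (M : Config)) (g := φ)

theorem coe_massDeriv (M : TestFun) (φ : Config) :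
    (massDeriv M φ : Config) = (M : Config) * φ := rfl

/-- `R = 1 - Δ₂ᴿ M`, with `Δ₂ᴿ` the retarded Green's operator of the perturbed theory: applying `P₂`
to the correction removes exactly the term `M φ`. -/
theorem exists_isMollerMap (m₁ : Config) (M : TestFun) : ∃ R, IsMollerMap m₁ M R := by
  obtain ⟨G, hG⟩ := exists_isRetardedGreen (m₁ + M)
  refine ⟨fun φ => φ - G (massDeriv M φ), fun φ => ?_, fun φ x hx => ?_⟩
  · rw [map_sub, hG.right_inverse, kleinGordon_add_mass, coe_massDeriv, add_sub_cancel_right]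
  · rw [functionalSupport_massFunctional] at hx
    have : G (massDeriv M φ) x = 0 := image_eq_zero_of_notMem_tsupport fun h =>
      hx (causalFuture_mono (tsupport_massDeriv_subset M φ) (hG.supp_subset _ h))
    change φ x - G (massDeriv M φ) x = φ x
    rw [this, sub_zero]

theorem IsMollerMap.tsupport_sub_subset {m₁ : Config} {M : TestFun} {R : Config → Config}
    (hR : IsMollerMap m₁ M R) (φ : Config) :
    tsupport (R φ - φ : Config) ⊆ causalFuture (tsupport (M : Config)) := by
  refine tsupport_subset_causalFuture M.2 fun z hz => ?_
  rw [← functionalSupport_massFunctional] at hz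
  exact sub_eq_zero.2 (hR.eq_outside φ z hz)

/-- No linearity of the maps is needed: for each `φ`, both corrections `R φ - φ` are past-compact
and have the same image under `P₂`. -/
theorem IsMollerMap.unique {m₁ : Config} {M : TestFun} {R R' : Config → Config}
    (hR : IsMollerMap m₁ M R) (hR' : IsMollerMap m₁ M R') : R = R' := by
  funext φ
  refine sub_left_injective (kleinGordon_injOn (m₁ + M) M.2 (hR.tsupport_sub_subset φ)
    (hR'.tsupport_sub_subset φ) ?_)
  rw [map_sub, map_sub, hR.intertwines, hR'.intertwines]

theorem neumannOp_apply (G : TestFun →ₗ[ℝ] Config) (M : TestFun) (φ : Config) :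
    neumannOp G M φ = -G (massDeriv M φ) := rfl

theorem kleinGordon_neumannOp {m₁ : Config} {M : TestFun} {G : TestFun →ₗ[ℝ] Config}
    (hG : IsRetardedGreen m₁ G) (φ : Config) :
    kleinGordon m₁ (neumannOp G M φ) = ((-M : TestFun) : Config) * φ := by
  rw [neumannOp_apply, map_neg, hG.right_inverse, coe_massDeriv]
  exact (neg_mul _ _).symm

theorem tsupport_neumannOp_subset {m₁ : Config} {M : TestFun} {G : TestFun →ₗ[ℝ] Config}
    (hG : IsRetardedGreen m₁ G) (φ : Config) :
    tsupport (neumannOp G M φ) ⊆ causalFuture (tsupport (M : Config)) := by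
  refine tsupport_subset_causalFuture M.2 fun z hz => ?_
  have : G (massDeriv M φ) z = 0 := image_eq_zero_of_notMem_tsupport fun h =>
    hz (causalFuture_mono (tsupport_massDeriv_subset M φ) (hG.supp_subset _ h))
  change -(G (massDeriv M φ) z) = 0
  rw [this, neg_zero]

/-- Both sides are supported in the future of `supp M` and have the image `-M R φ` under `P₁`. -/
theorem IsMollerMap.sub_eq_neumannOp {m₁ : Config} {M : TestFun} {R : Config → Config}
    {G : TestFun →ₗ[ℝ] Config} (hR : IsMollerMap m₁ M R) (hG : IsRetardedGreen m₁ G)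
    (φ : Config) : R φ - φ = neumannOp G M (R φ) := by
  refine kleinGordon_injOn m₁ M.2 (hR.tsupport_sub_subset φ) (tsupport_neumannOp_subset hG _) ?_
  have h := hR.intertwines φ
  rw [kleinGordon_add_mass] at h
  rw [map_sub, ← h, kleinGordon_neumannOp hG]
  change _ = -(M : Config) * R φ
  ring

/-- Telescoping of `φ = Rφ - r(Rφ)`. The limit is known beforehand, so only the remainder has to be
estimated. -/
theorem IsMollerMap.sum_neumannOp {m₁ : Config} {M : TestFun} {R : Config → Config}
    {G : TestFun →ₗ[ℝ] Config} (hR : IsMollerMap m₁ M R) (hG : IsRetardedGreen m₁ G)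
    (φ : Config) (N : ℕ) :
    ∑ n ∈ Finset.range N, (neumannOp G M ^ n) φ = R φ - (neumannOp G M ^ N) (R φ) := by
  induction N with
  | zero => simp
  | succ N ih =>
    rw [Finset.sum_range_succ, ih, pow_succ, Module.End.mul_apply, ← hR.sub_eq_neumannOp hG,
      map_sub]
    abel

/-- The powers of the Neumann operator decay geometrically in every weighted seminorm. -/
theorem exists_hasExpBound_neumannOp_pow {m₁ : Config} {M : TestFun}
    {G : TestFun →ₗ[ℝ] Config} (hG : IsRetardedGreen m₁ G) (ψ : Config) (T : ℝ) (k : ℕ) :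
    ∃ a A : ℝ, 0 ≤ A ∧
      ∀ n : ℕ, HasExpBound a T k (A * (1 / 2) ^ n) ((neumannOp G M ^ (n + 1)) ψ) := by
  obtain ⟨C, hC0, hC⟩ := exists_mul_hasExpBound ((-M : TestFun) : Config) M.2 T k
  obtain ⟨a, ha⟩ := exists_hasExpBound_of_kleinGordon m₁ M.2 T k
    (ε := 1 / (2 * (C + 1))) (by positivity)
  -- `ψ` itself may have arbitrary support; past-compactness starts with the first power, hence the
  -- shift to `n + 1`.
  have hs (n : ℕ) : tsupport ((neumannOp G M ^ (n + 1)) ψ) ⊆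
      causalFuture (tsupport (M : Config)) := by
    rw [pow_succ', Module.End.mul_apply]
    exact tsupport_neumannOp_subset hG _
  obtain ⟨A, hA, h0⟩ := exists_hasExpBound M.2 (hs 0) a T k
  refine ⟨a, A, hA, fun n => ?_⟩
  induction n with
  | zero => simpa using h0
  | succ n ih =>
    have h1 := hC _ (hs n) a _ (by positivity) ih
    have h2 := ha _ (hs (n + 1)) (C * (A * (1 / 2) ^ n)) (by positivity) (by
      rw [pow_succ', Module.End.mul_apply, kleinGordon_neumannOp hG]
      exact h1)
    refine h2.mono ?_
    have hp : 0 ≤ A * (1 / 2) ^ n := by positivity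
    rw [div_mul_eq_mul_div, div_le_iff₀ (by positivity), pow_succ]
    nlinarith

theorem Config.tendsto_of_norm_sub {u : ℕ → Config} {v : Config}
    (h : ∀ (k : ℕ) (S : Set Minkowski), IsCompact S → ∃ b : ℕ → ℝ, Tendsto b atTop (𝓝 0) ∧
      ∀ᶠ n in atTop, ∀ z ∈ S, ‖iteratedFDeriv ℝ k (v - u n : Config) z‖ ≤ b n) :
    Tendsto u atTop (𝓝 v) := by
  rw [nhds_iInf, tendsto_iInf]
  intro k
  rw [nhds_induced, tendsto_comap_iff,
    ContinuousMap.tendsto_iff_forall_isCompact_tendstoUniformlyOn]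
  intro S hS
  obtain ⟨b, hb, hle⟩ := h k S hS
  rw [Metric.tendstoUniformlyOn_iff]
  intro ε hε
  filter_upwards [hle, hb.eventually (gt_mem_nhds hε)] with n hn hbn z hz
  have e : iteratedFDeriv ℝ k (v - u n : Config) z =
      iteratedFDeriv ℝ k v z - iteratedFDeriv ℝ k (u n) z :=
    iteratedFDeriv_sub_apply (v.contDiff.of_le (mod_cast le_top)).contDiffAt
      ((u n).contDiff.of_le (mod_cast le_top)).contDiffAt
  rw [dist_eq_norm]
  change ‖iteratedFDeriv ℝ k v z - iteratedFDeriv ℝ k (u n) z‖ < ε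
  rw [← e]
  exact (hn z hz).trans_lt hbn

theorem IsMollerMap.tendsto_neumann {m₁ : Config} {M : TestFun} {R : Config → Config}
    {G : TestFun →ₗ[ℝ] Config} (hR : IsMollerMap m₁ M R) (hG : IsRetardedGreen m₁ G)
    (φ : Config) :
    Tendsto (fun N : ℕ => ∑ n ∈ Finset.range N, (neumannOp G M ^ n) φ) atTop (𝓝 (R φ)) := by
  -- The decay estimate only covers powers from the first on.
  rw [← tendsto_add_atTop_iff_nat 1]
  refine Config.tendsto_of_norm_sub fun k S hS => ?_
  obtain ⟨r, hr⟩ := hS.isBounded.subset_closedBall 0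
  obtain ⟨a, A, hA, h⟩ := exists_hasExpBound_neumannOp_pow (M := M) hG (R φ) r k
  obtain ⟨E, hE⟩ := hS.exists_bound_of_continuousOn (f := fun z : Minkowski => Real.exp (a * z.1))
    (by fun_prop)
  refine ⟨fun n => A * (1 / 2) ^ n * E, ?_, Eventually.of_forall fun n z hz => ?_⟩
  · have := ((tendsto_pow_atTop_nhds_zero_of_lt_one (r := (1 / 2 : ℝ)) (by norm_num)
      (by norm_num)).const_mul A).mul_const E
    simpa using this
  · have hzr : z.1 ≤ r := (le_abs_self _).trans ((norm_fst_le z).trans (by simpa using hr hz))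
    rw [hR.sum_neumannOp hG, sub_sub_cancel]
    refine (h n k le_rfl z hzr).trans (mul_le_mul_of_nonneg_left ?_ (by positivity))
    exact (le_abs_self _).trans (hE z hz)

end Moller

theorem mainTheorem11 (m₁ : Config) (M : TestFun) :
    (∃! G : TestFun →ₗ[ℝ] Config, IsRetardedGreen m₁ G) ∧
    (∃! R : Config → Config, IsMollerMap m₁ M R) ∧
    ∀ (G : TestFun →ₗ[ℝ] Config) (R : Config → Config),
      IsRetardedGreen m₁ G → IsMollerMap m₁ M R →
      ∀ φ : Config,
        Tendsto (fun N : ℕ => ∑ n ∈ Finset.range N, (neumannOp G M ^ n) φ) atTop (𝓝 (R φ)) := by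
  refine ⟨?_, ?_, fun G R hG hR φ => hR.tendsto_neumann hG φ⟩
  · obtain ⟨G, hG⟩ := exists_isRetardedGreen m₁
    exact ⟨G, hG, fun G' hG' => hG'.unique hG⟩
  · obtain ⟨R, hR⟩ := exists_isMollerMap m₁ M
    exact ⟨R, hR, fun R' hR' => hR'.unique hR⟩
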